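/- **Setting.** Let $W^1,W^2,\dots$ be independent standard Brownian motions on a probability space $(\Omega,\mathcal F,P)$, let $\mathcal F_0\subset\mathcal F$ be a $\sigma$-field independent of them, and $\mathcal F_t=\mathcal F_0\vee\sigma(W^j_s: j\ge1,\ s\le t)$. Let $\Theta^0=(\Theta^0_{ij})_{i,j\ge1}$ be a real matrix and $\sigma^0_i$, $i\ge 1$, real numbers, and let $\phi_j:\mathbb R\to\mathbb R$, $j\ge 1$, be functions. Let $p=p_n$ be the dimension and $\Delta_n>0$ the step at stage $n$. At stage $n$ the process $X=X^{(n)}$ is $p_n$-dimensional, continuous and $(\mathcal F_t)$-adapted with $\mathcal F_0$-measurable initial value, and $$X^i_t=X^i_0+\int_0^t\sum_{j=1}^{p_n}\Theta^0_{ij}\,\phi_j(X^j_s)\,ds+\sigma^0_iW^i_t,\qquad 1\le i\le p_n,\ t\ge 0 .$$ It is observed at the times $t_k=k\Delta_n$, $k=0,\dots,n$. At stage $n$, $\Theta^0_i=(\Theta^0_{ij})_{j\le p_n}\in\mathbb R^{p_n}$ is the $i$-th row, $T^i_0=\{j\le p_n:\Theta^0_{ij}\ne0\}$ its support and $S_i=|T_0^i|$.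 The maximal number $S^*$ of nonzero entries in a row of the infinite matrix $\Theta^0$ is assumed finite and positive. **Regularity conditions.** (i) $p_n\to\infty$, $\log p_n=o(\sqrt{n\Delta_n})$, and $\Delta_n\asymp n^{-\alpha}$ for some $\alpha\in(1/2,1)$. (ii) There are $L,L'>0$ with $|\phi_j(x)|\le L$ and $|\phi_j(x)-\phi_j(y)|\le L'|x-y|$ for all $j,x,y$. (iii) For every $\nu\ge1$, $\sup E|X^{(n),i}_t|^\nu<\infty$, the supremum being over all $n$, $i\le p_n$ and $t\ge0$. (iv) There are positive constants $K_1,\dots,K_4$ with $|\Theta^0_{ij}|<K_1$ for all $i,j$, $|\Theta^0_{ij}|>K_2$ whenever $\Theta^0_{ij}\ne0$, and $K_4<|\sigma_i^0|<K_3$ for all $i$. (v) For each $i\ge1$ put $T=\{j\ge1:\Theta^0_{ij}\neq0\}$. The process $X_T=(X^j)_{j\in T}$ (defined once $p_n\ge\max T$) is ergodic on $[0,T_n]$, $T_n=n\Delta_n$: there is a probability measure $\mu^i_0$ on $\mathbb R^{T}$ with $\frac1{T_n}\int_0^{T_n}f(X_{t,T})\,dt\to\int f\,d\mu_0^i$ in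 probability as $n\to\infty$, for every bounded continuous $f$. **Estimators.** Put $\phi(x)=(\phi_j(x_j))_{j\le p_n}$ and, for $i\le p_n$, $$\hat\sigma_i^2=\frac1{n\Delta_n}\sum_{k=1}^n(X^i_{t_k}-X^i_{t_{k-1}})^2,\qquad V_n^i=\frac1{n\hat\sigma_i^2}\sum_{k=1}^n\phi(X_{t_{k-1}})\phi(X_{t_{k-1}})^T,$$ $$\psi_n^i(\theta)=\frac1{n\Delta_n\hat\sigma_i^2}\sum_{k=1}^n\phi(X_{t_{k-1}})\big(X^i_{t_k}-X^i_{t_{k-1}}-\theta^T\phi(X_{t_{k-1}})\Delta_n\big),\quad\theta\in\mathbb R^{p_n}.$$ The tuning parameter $\gamma_n>0$ has the exact order $\gamma_n\asymp\log(1+p_n^2)/\sqrt{n\Delta_n}$. The Dantzig selector $\hat\Theta_i$ is any minimizer of $\|\theta\|_1$ over $\{\theta\in\mathbb R^{p_n}:\|\psi_n^i(\theta)\|_\infty\le\gamma_n\}$. **Factors.** For $T\subset\{1,\dots,p_n\}$ let $C_T=\{h\in\mathbb R^{p_n}:\|h_{T^c}\|_1\le\|h_T\|_1\}$, and put, in $[0,\infty]$,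 $$\kappa(T,V)=\inf_{0\ne h\in C_T}\frac{|T|^{1/2}(h^TVh)^{1/2}}{\|h_T\|_1},\qquad F_q(T,V)=\inf_{0\ne h\in C_T}\frac{|T|^{1/q}\,h^TVh}{\|h_T\|_1\|h\|_q},$$ with $\inf\emptyset=\infty$. **Matrix condition.** For every $\epsilon>0$ there are $\delta>0$ and $n_0$ such that $P(\inf_{i\le p_n}\kappa(T_0^i,V_n^i)>\delta)\ge1-\epsilon$ for all $n\ge n_0$. **Theorem.** Under the regularity conditions and the matrix condition: (i) $\displaystyle\lim_{n\to\infty}P\Big(\sup_{1\le i\le p_n}\|\hat\Theta_i-\Theta_i^0\|_1\ge\frac{8S^*\gamma_n}{\inf_{1\le i\le p_n}\kappa^2(T_0^i,V_n^i)}\Big)=0$; (ii) for every $q\in[1,\infty)$, $\displaystyle\lim_{n\to\infty}P\Big(\sup_{1\le i\le p_n}\|\hat\Theta_i-\Theta_i^0\|_q\ge\frac{4S^{*1/q}\gamma_n}{\inf_{1\le i\le p_n}F_q(T_0^i,V_n^i)}\Big)=0$. The quotients are taken in $[0,\infty]$ (value $\infty$ if the denominator is $0$). Moreover, for every $q\in[1,\infty)$,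 in particular for $q=1$ and $q=2$, $\sup_{1\le i\le p_n}\|\hat\Theta_i-\Theta^0_i\|_q\to0$ in probability. -/

import Mathlib

open MeasureTheory ProbabilityTheory Filter Topology Asymptotics
open scoped NNReal ENNReal BoundedContinuousFunction

noncomputable section

namespace DantzigDiffusion

/-! ### Norms, the cone and the factors -/

section Deterministic

variable {ι : Type*} [Fintype ι]

/-- The `l_q` norm `(∑ |v_j|^q)^(1/q)` of a vector, for a real exponent `q`. -/
def lqNorm (q : ℝ) (v : ι → ℝ) : ℝ := (∑ j, |v j| ^ q) ^ (1 / q)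

/-- The `l_1` norm of the sub-vector `v_T`. -/
def l1On (T : Finset ι) (v : ι → ℝ) : ℝ := ∑ j ∈ T, |v j|

/-- The `l_1` norm. -/
def l1Norm (v : ι → ℝ) : ℝ := ∑ j, |v j|

open Classical in
/-- The support of a vector. -/
def supp (v : ι → ℝ) : Finset ι := Finset.univ.filter fun j => v j ≠ 0

open Classical in
/-- The cone `C_T` of vectors `h` with `‖h_{Tᶜ}‖₁ ≤ ‖h_T‖₁`. -/
def cone (T : Finset ι) : Set (ι → ℝ) := {h | l1On Tᶜ h ≤ l1On T h}

/-- The quadratic form `hᵀ V h`. -/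
def quad (V : Matrix ι ι ℝ) (h : ι → ℝ) : ℝ := h ⬝ᵥ V.mulVec h

/-- The compatibility factor `κ(T, V)`.  It lives in `[0, ∞]`, so that the infimum over the empty
set (the case `T = ∅`) is `∞`; the denominators do not vanish on `C_T \ {0}`. -/
def compatibilityFactor (T : Finset ι) (V : Matrix ι ι ℝ) : ℝ≥0∞ :=
  ⨅ (h : ι → ℝ) (_ : h ≠ 0) (_ : h ∈ cone T),
    ENNReal.ofReal (√(T.card : ℝ) * √(quad V h) / l1On T h)

/-- The weak cone invertibility factor `F_q(T, V)`, for `1 ≤ q < ∞`, as an element of `[0, ∞]`. -/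
def weakConeFactor (q : ℝ) (T : Finset ι) (V : Matrix ι ι ℝ) : ℝ≥0∞ :=
  ⨅ (h : ι → ℝ) (_ : h ≠ 0) (_ : h ∈ cone T),
    ENNReal.ofReal ((T.card : ℝ) ^ (1 / q) * quad V h / (l1On T h * lqNorm q h))

/-! ### The estimators, as functions of one observed path

`n` is the number of increments, `Δ` the step, `x k` the observation at the time `k * Δ`,
`k = 0, …, n`; `φ j` acts on the `j`-th coordinate. -/

/-- The estimator `σ̂_i²` of the squared diffusion coefficient. -/
def sigmaHatSq (n : ℕ) (Δ : ℝ) (x : ℕ → ι → ℝ) (i : ι) : ℝ :=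
  1 / (n * Δ) * ∑ k ∈ Finset.range n, (x (k + 1) i - x k i) ^ 2

/-- The score `ψ_n(θ)` of row `i`: the gradient in `θ` of the log-quasi-likelihood with `σ̂_i`
plugged in. -/
def score (φ : ι → ℝ → ℝ) (n : ℕ) (Δ : ℝ) (x : ℕ → ι → ℝ) (i : ι) (θ : ι → ℝ) : ι → ℝ :=
  fun j => 1 / (n * Δ * sigmaHatSq n Δ x i) *
    ∑ k ∈ Finset.range n,
      φ j (x k j) * (x (k + 1) i - x k i - (∑ l, θ l * φ l (x k l)) * Δ)

/-- The matrix `V_n^i`: minus the Hessian of the log-quasi-likelihood of row `i`. -/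
def hessian (φ : ι → ℝ → ℝ) (n : ℕ) (Δ : ℝ) (x : ℕ → ι → ℝ) (i : ι) : Matrix ι ι ℝ :=
  Matrix.of fun j l => 1 / (n * sigmaHatSq n Δ x i) *
    ∑ k ∈ Finset.range n, φ j (x k j) * φ l (x k l)

/-- The constraint set `C_n^i = {θ : ‖ψ_n(θ)‖_∞ ≤ γ}`. -/
def feasible (φ : ι → ℝ → ℝ) (n : ℕ) (Δ γ : ℝ) (x : ℕ → ι → ℝ) (i : ι) : Set (ι → ℝ) :=
  {θ | ∀ j, |score φ n Δ x i θ j| ≤ γ}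

/-- `θ` is a Dantzig selector for row `i`: a minimizer of the `l_1` norm on the constraint set. -/
def IsDantzigSelector (φ : ι → ℝ → ℝ) (n : ℕ) (Δ γ : ℝ) (x : ℕ → ι → ℝ) (i : ι)
    (θ : ι → ℝ) : Prop :=
  θ ∈ feasible φ n Δ γ x i ∧ ∀ θ' ∈ feasible φ n Δ γ x i, l1Norm θ ≤ l1Norm θ'

end Deterministic

/-! ### The model -/

section Model

variable {Ω : Type*}

/-- The `σ`-field `ℱ_t = ℱ_0 ∨ σ(W_s^j : j, s ≤ t)`. -/
abbrev filt (F0 : MeasurableSpace Ω) (W : ℕ → ℝ≥0 → Ω → ℝ) (t : ℝ≥0) : MeasurableSpace Ω :=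
  F0 ⊔ ⨆ (j : ℕ) (s : ℝ≥0) (_ : s ≤ t), MeasurableSpace.comap (W j s) inferInstance

/-- `W^0, W^1, …` are independent standard Brownian motions and the `σ`-field `F0` is
independent of them. -/
structure IsDrivingNoise (F0 : MeasurableSpace Ω) [mΩ : MeasurableSpace Ω] (P : Measure Ω)
    (W : ℕ → ℝ≥0 → Ω → ℝ) :
    Prop where
  le : F0 ≤ mΩ
  measurable : ∀ j t, Measurable[mΩ] (W j t)
  brownian : ∀ j, IsBrownianReal (W j) P
  indep : iIndepFun (fun (j : ℕ) (ω : Ω) (t : ℝ≥0) => W j t ω) P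
  indep_F0 : Indep F0 (⨆ (j : ℕ) (t : ℝ≥0), MeasurableSpace.comap (W j t) inferInstance) P

/-- The `d`-dimensional process `X` (continuous and adapted, with `ℱ_0`-measurable initial value)
solves `X_t^i = X_0^i + ∫₀ᵗ ∑_j Θ_ij φ_j(X_s^j) ds + σ_i W_t^i`, `i < d`, where only the upper left
`d × d` block of the infinite matrix `Θ` enters. -/
structure IsSolution (F0 : MeasurableSpace Ω) [MeasurableSpace Ω] (P : Measure Ω)
    (W : ℕ → ℝ≥0 → Ω → ℝ) (Θ : ℕ → ℕ → ℝ) (σ : ℕ → ℝ) (φ : ℕ → ℝ → ℝ) (d : ℕ) (X : ℝ≥0 → Ω → Fin d → ℝ) :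
    Prop where
  init : ∀ i, Measurable[F0] fun ω => X 0 ω i
  adapted : ∀ t i, Measurable[filt F0 W t] fun ω => X t ω i
  cont : ∀ᵐ ω ∂P, Continuous fun t => X t ω
  eqn : ∀ᵐ ω ∂P, ∀ (i : Fin d) (t : ℝ≥0),
    X t ω i = X 0 ω i
      + (∫ s in (0 : ℝ)..t, ∑ j : Fin d, Θ i j * φ j (X s.toNNReal ω j)) + σ i * W i t ω

/-- Standing sparsity assumption: `S = sup_i S_i`, where `S_i` is the number of nonzero entries of
row `i`, is finite and positive. -/
def IsSparse (Θ : ℕ → ℕ → ℝ) (S : ℕ) : Prop :=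
  0 < S ∧ IsLUB (Set.range fun i => {j | Θ i j ≠ 0}.encard) (S : ℕ∞)

/-- The part of the `d`-dimensional vector `x` with indices in `T ⊆ ℕ` (indices that are not
smaller than `d` are given the value `0`; if `T` is finite there are none as soon as `d` is
large). -/
def restrictTo (T : Set ℕ) {d : ℕ} (x : Fin d → ℝ) : T → ℝ :=
  fun j => if h : (j : ℕ) < d then x ⟨j, h⟩ else 0

/-- The regularity conditions. `p n` is the dimension, `Δ n` the step, `X n` the process when
there are `n` increments. -/
structure Regularity [MeasurableSpace Ω] (P : Measure Ω) (Θ : ℕ → ℕ → ℝ) (σ : ℕ → ℝ) (φ : ℕ → ℝ → ℝ)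
    (p : ℕ → ℕ) (Δ : ℕ → ℝ≥0) (X : (n : ℕ) → ℝ≥0 → Ω → Fin (p n) → ℝ) : Prop where
  dim_tendsto : Tendsto p atTop atTop
  log_dim : (fun n => Real.log (p n)) =o[atTop] fun n => √(n * (Δ n : ℝ))
  step_pos : ∀ n, 0 < Δ n
  step_order : ∃ α : ℝ, 1 / 2 < α ∧ α < 1 ∧
    (fun n => (Δ n : ℝ)) =Θ[atTop] fun n : ℕ => (n : ℝ) ^ (-α)
  phi_bounded : ∃ L > 0, ∀ j x, |φ j x| ≤ L
  phi_lipschitz : ∃ L' > 0, ∀ j x y, |φ j x - φ j y| ≤ L' * |x - y|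
  moments : ∀ ν : ℝ, 1 ≤ ν → ∃ C : ℝ≥0, ∀ n (i : Fin (p n)) t,
    ∫⁻ ω, ENNReal.ofReal (|X n t ω i| ^ ν) ∂P ≤ C
  drift_upper : ∃ K₁ > 0, ∀ i j, |Θ i j| < K₁
  drift_lower : ∃ K₂ > 0, ∀ i j, Θ i j ≠ 0 → K₂ < |Θ i j|
  diff_upper : ∃ K₃ > 0, ∀ i, |σ i| < K₃
  diff_lower : ∃ K₄ > 0, ∀ i, K₄ < |σ i|
  /-- For each row `i` the sub-process with indices in the support of the row is ergodic on
  `[0, T_n]`, `T_n = n Δ_n`: its time averages converge to the averages under some probability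
  measure `μ`. -/
  ergodic : ∀ i : ℕ, ∃ μ : Measure ({j | Θ i j ≠ 0} → ℝ), IsProbabilityMeasure μ ∧
    ∀ f : ({j | Θ i j ≠ 0} → ℝ) →ᵇ ℝ,
      TendstoInMeasure P
        (fun n ω => 1 / (n * (Δ n : ℝ)) *
          ∫ s in (0 : ℝ)..(n * Δ n), f (restrictTo _ (X n s.toNNReal ω)))
        atTop (fun _ => ∫ x, f x ∂μ)

/-! ### The objects of the model at stage `n` -/

/-- The row `Θ_i` as a vector in `ℝ^d`. -/
def row (Θ : ℕ → ℕ → ℝ) {d : ℕ} (i : Fin d) : Fin d → ℝ := fun j => Θ i j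

/-- The discrete observations `X_{k Δ}(ω)`, `k = 0, 1, …`. -/
def sample {d : ℕ} (Δ : ℝ≥0) (X : ℝ≥0 → Ω → Fin d → ℝ) (ω : Ω) : ℕ → Fin d → ℝ :=
  fun k => X (k * Δ) ω

/-- The random factor `κ(T_0^i, V_n^i)`. -/
def kappa (Θ : ℕ → ℕ → ℝ) (φ : ℕ → ℝ → ℝ) {d : ℕ} (n : ℕ) (Δ : ℝ≥0)
    (X : ℝ≥0 → Ω → Fin d → ℝ) (i : Fin d) (ω : Ω) : ℝ≥0∞ :=
  compatibilityFactor (supp (row Θ i)) (hessian (fun j => φ j) n Δ (sample Δ X ω) i)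

/-- The random factor `F_q(T_0^i, V_n^i)`. -/
def weakF (q : ℝ) (Θ : ℕ → ℕ → ℝ) (φ : ℕ → ℝ → ℝ) {d : ℕ} (n : ℕ) (Δ : ℝ≥0)
    (X : ℝ≥0 → Ω → Fin d → ℝ) (i : Fin d) (ω : Ω) : ℝ≥0∞ :=
  weakConeFactor q (supp (row Θ i)) (hessian (fun j => φ j) n Δ (sample Δ X ω) i)

/-- With probability close to one, the compatibility factors are bounded away from zero,
uniformly in the row. -/
def MatrixCondition [MeasurableSpace Ω] (P : Measure Ω) (Θ : ℕ → ℕ → ℝ) (φ : ℕ → ℝ → ℝ)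
    (p : ℕ → ℕ) (Δ : ℕ → ℝ≥0) (X : (n : ℕ) → ℝ≥0 → Ω → Fin (p n) → ℝ) : Prop :=
  ∀ ε : ℝ, 0 < ε → ∃ δ : ℝ, 0 < δ ∧ ∃ n₀ : ℕ, ∀ n ≥ n₀,
    ENNReal.ofReal (1 - ε) ≤
      P {ω | ENNReal.ofReal δ < ⨅ i : Fin (p n), kappa Θ φ n (Δ n) (X n) i ω}

end Model

end DantzigDiffusion

end

open DantzigDiffusion

/-!
The proof separates a deterministic inequality from a probabilistic one.

*Deterministic part.* If the true row `Θ_i` satisfies its constraint strictly, `‖ψ(Θ_i)‖_∞ < γ`,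
then minimality of the `l_1` norm puts the error `h` of the Dantzig selector into the cone of the
true support `T` (`sub_mem_cone_supp`). The score is affine with slope `-V`
(`mulVec_hessian_sub`), so `‖V h‖_∞ < 2 γ` and `hᵀ V h < 4 γ ‖h_T‖₁` unless `h = 0`
(`quad_hessian_lt`). Comparison with the definitions of the factors gives both bounds of the
theorem with strict inequalities. Once the dimension is so large that some row has a nonempty
support, the infimum of the factors is finite, the quotients are positive, and the case `h = 0` is
strict as well.

*Probabilistic part.* It remains to see that all true rows are strictly feasible with probability
tending to one. Inserting the equation into the score at the true row leaves a discretized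
stochastic integral and the error of freezing the drift on the sampling intervals, both divided by
`σ̂_i²` (`IsPath.abs_score_row_le`). Write `ℓ = log (1 + p²)`. Three union bounds suffice:
* the realized quadratic variations of the noise are at least a quarter of their mean, hence the
  `σ̂_i²` are bounded below (`IsDrivingNoise.measure_sum_sq_le`, failure probability `p e^{-n/4}`);
* the stochastic integrals have bounded adapted integrands, hence are sub-Gaussian on the scale
  `√(n Δ)`, and all `p²` of them are below a small multiple of `√(n Δ) ℓ`
  (`IsDrivingNoise.measure_le_abs_sum_mul`);
* the mean fluctuation of each Brownian path inside the sampling intervals is at most `√Δ ℓ`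
  (`IsDrivingNoise.measure_le_noiseFluct`). Compared with the threshold of order `ℓ / √(n Δ)`, the
  discretization error is smaller by the factor `√n Δ`, which tends to zero because `α > 1/2`.
The exponential bounds rest on the independence of the Brownian increments of the past `σ`-field
(`IsDrivingNoise.indep_increment`).

For consistency, the threshold tends to zero and the matrix condition bounds the factors from
below. That condition is turned into a bound for the complementary event, which is measurable
since the compatibility factor is an upper semicontinuous function of the matrix.
-/

open DantzigDiffusion

/-! ### Independence and exponential bounds -/

section Independence

variable {Ω : Type*}

/-- The intersections `u ∩ v` with `u ∈ m₂`, `v ∈ m₃` form a generating `π`-system of `m₂ ⊔ m₃`. -/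
theorem indep_sup_right_of_indep_sup {m₁ m₂ m₃ : MeasurableSpace Ω} {mΩ : MeasurableSpace Ω}
    {P : Measure Ω} [IsProbabilityMeasure P]
    (h₁ : m₁ ≤ mΩ) (h₂ : m₂ ≤ mΩ) (h₃ : m₃ ≤ mΩ)
    (h12 : Indep m₁ m₂ P) (h123 : Indep (m₁ ⊔ m₂) m₃ P) : Indep m₁ (m₂ ⊔ m₃) P := by
  let π : Set (Set Ω) := {s | ∃ u v, MeasurableSet[m₂] u ∧ MeasurableSet[m₃] v ∧ s = u ∩ v}
  have hπ : IsPiSystem π := by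
    rintro _ ⟨u, v, hu, hv, rfl⟩ _ ⟨u', v', hu', hv', rfl⟩ -
    exact ⟨u ∩ u', v ∩ v', hu.inter hu', hv.inter hv', Set.inter_inter_inter_comm _ _ _ _⟩
  have hgen : m₂ ⊔ m₃ = MeasurableSpace.generateFrom π := by
    apply le_antisymm
    · refine sup_le (fun s hs => ?_) (fun s hs => ?_)
      · exact MeasurableSpace.measurableSet_generateFrom
          ⟨s, Set.univ, hs, MeasurableSet.univ, (Set.inter_univ s).symm⟩
      · exact MeasurableSpace.measurableSet_generateFrom
          ⟨Set.univ, s, MeasurableSet.univ, hs, (Set.univ_inter s).symm⟩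
    · refine MeasurableSpace.generateFrom_le ?_
      rintro _ ⟨u, v, hu, hv, rfl⟩
      exact ((le_sup_left : m₂ ≤ m₂ ⊔ m₃) _ hu).inter ((le_sup_right : m₃ ≤ m₂ ⊔ m₃) _ hv)
  refine IndepSets.indep h₁ (sup_le h₂ h₃) (@MeasurableSpace.isPiSystem_measurableSet Ω m₁) hπ
    (@MeasurableSpace.generateFrom_measurableSet Ω m₁).symm hgen ?_
  rw [IndepSets_iff]
  rintro s _ (hs : MeasurableSet[m₁] s) ⟨u, v, hu, hv, rfl⟩
  rw [Indep_iff] at h12 h123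
  rw [← Set.inter_assoc, h123 _ _ (((le_sup_left : m₁ ≤ m₁ ⊔ m₂) _ hs).inter
    ((le_sup_right : m₂ ≤ m₁ ⊔ m₂) _ hu)) hv, h12 _ _ hs hu,
    h123 u v ((le_sup_right : m₂ ≤ m₁ ⊔ m₂) _ hu) hv, mul_assoc]

/-- Conditioning on `G`: an integrand `g (a, ξ)` with `a` known to `G` and `ξ` independent of `G`
can be integrated in `ξ` first. -/
theorem lintegral_mul_comp_le_of_indep {G : MeasurableSpace Ω} {mΩ : MeasurableSpace Ω}
    {P : Measure Ω} [IsProbabilityMeasure P]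
    (hG : G ≤ mΩ) {Y : Ω → ℝ≥0∞} (hY : Measurable[G] Y) {a : Ω → ℝ} (ha : Measurable[G] a)
    {ξ : Ω → ℝ} (hξ : Measurable ξ) (hind : Indep (MeasurableSpace.comap ξ inferInstance) G P)
    {g : ℝ → ℝ → ℝ≥0∞} (hg : Measurable (Function.uncurry g)) {c : ℝ≥0∞}
    (hc : ∀ ω, ∫⁻ x, g (a ω) x ∂(P.map ξ) ≤ c) :
    ∫⁻ ω, Y ω * g (a ω) (ξ ω) ∂P ≤ (∫⁻ ω, Y ω ∂P) * c := by
  have hYa : Measurable[G] fun ω => (Y ω, a ω) := hY.prodMk ha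
  have hYa' : Measurable fun ω => (Y ω, a ω) := hYa.mono hG le_rfl
  have hI : IndepFun (fun ω => (Y ω, a ω)) ξ P := by
    rw [IndepFun_iff_Indep]
    exact indep_of_indep_of_le_left hind.symm hYa.comap_le
  have hmap := (indepFun_iff_map_prod_eq_prod_map_map hYa'.aemeasurable hξ.aemeasurable).1 hI
  have : IsProbabilityMeasure (P.map ξ) := Measure.isProbabilityMeasure_map hξ.aemeasurable
  have hF : Measurable fun z : (ℝ≥0∞ × ℝ) × ℝ => z.1.1 * g z.1.2 z.2 :=
    (measurable_fst.comp measurable_fst).mul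
      (hg.comp ((measurable_snd.comp measurable_fst).prodMk measurable_snd))
  calc ∫⁻ ω, Y ω * g (a ω) (ξ ω) ∂P
      = ∫⁻ z, z.1.1 * g z.1.2 z.2 ∂(P.map fun ω => ((Y ω, a ω), ξ ω)) := by
        rw [lintegral_map hF (hYa'.prodMk hξ)]
    _ = ∫⁻ z, ∫⁻ x, z.1 * g z.2 x ∂(P.map ξ) ∂(P.map fun ω => (Y ω, a ω)) := by
        rw [hmap, lintegral_prod _ hF.aemeasurable]
    _ = ∫⁻ ω, ∫⁻ x, Y ω * g (a ω) x ∂(P.map ξ) ∂P := by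
        rw [lintegral_map hF.lintegral_prod_right' hYa']
    _ ≤ ∫⁻ ω, Y ω * c ∂P := by
        refine lintegral_mono fun ω => ?_
        rw [lintegral_const_mul (Y ω) (f := g (a ω)) (hg.comp measurable_prodMk_left)]
        exact mul_le_mul_right (hc ω) _
    _ = (∫⁻ ω, Y ω ∂P) * c := lintegral_mul_const _ (hY.mono hG le_rfl)

/-- A product of adapted factors, each of conditional mean at most `c`, has mean at most `c ^ n`. -/
theorem lintegral_prod_comp_le_pow {mΩ : MeasurableSpace Ω} {P : Measure Ω}
    [IsProbabilityMeasure P] {G : ℕ → MeasurableSpace Ω}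
    (hG : ∀ k, G k ≤ mΩ) (hmono : Monotone G) {a ξ : ℕ → Ω → ℝ}
    (ha : ∀ k, Measurable[G k] (a k)) (hξ : ∀ k, Measurable[G (k + 1)] (ξ k))
    (hind : ∀ k, Indep (MeasurableSpace.comap (ξ k) inferInstance) (G k) P)
    {g : ℝ → ℝ → ℝ≥0∞} (hg : Measurable (Function.uncurry g)) {c : ℝ≥0∞}
    (hc : ∀ k ω, ∫⁻ x, g (a k ω) x ∂(P.map (ξ k)) ≤ c) (n : ℕ) :
    ∫⁻ ω, ∏ k ∈ Finset.range n, g (a k ω) (ξ k ω) ∂P ≤ c ^ n := by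
  have hmeas : ∀ n, Measurable[G n] fun ω => ∏ k ∈ Finset.range n, g (a k ω) (ξ k ω) := by
    intro n
    refine Finset.measurable_fun_prod _ fun k hk => ?_
    have hk' : k + 1 ≤ n := Finset.mem_range.1 hk
    exact hg.comp (((ha k).mono (hmono ((Nat.le_succ k).trans hk')) le_rfl).prodMk
      ((hξ k).mono (hmono hk') le_rfl))
  induction n with
  | zero => simp
  | succ n ih =>
    simp_rw [Finset.prod_range_succ]
    refine (lintegral_mul_comp_le_of_indep (hG n) (hmeas n) (ha n)
      ((hξ n).mono (hG _) le_rfl) (hind n) hg (hc n)).trans ?_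
    rw [pow_succ]
    exact mul_le_mul_left ih c

end Independence

section Gaussian

theorem lintegral_exp_mul_gaussianReal (v : ℝ≥0) (t : ℝ) :
    ∫⁻ x, ENNReal.ofReal (Real.exp (t * x)) ∂(gaussianReal 0 v)
      = ENNReal.ofReal (Real.exp (v * t ^ 2 / 2)) := by
  rw [← ofReal_integral_eq_lintegral_ofReal (integrable_exp_mul_gaussianReal t)
    (ae_of_all _ fun x => (Real.exp_pos _).le)]
  have h := congrFun (mgf_fun_id_gaussianReal (μ := 0) (v := v)) t
  simp only [mgf, zero_mul, zero_add] at h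
  rw [h]

theorem lintegral_exp_mul_gaussianReal_le {v : ℝ≥0} {t B : ℝ} (ht : |t| ≤ B) :
    ∫⁻ x, ENNReal.ofReal (Real.exp (t * x)) ∂(gaussianReal 0 v)
      ≤ ENNReal.ofReal (Real.exp (v * B ^ 2 / 2)) := by
  rw [lintegral_exp_mul_gaussianReal]
  have : t ^ 2 ≤ B ^ 2 := sq_le_sq.2 (ht.trans (le_abs_self B))
  gcongr

theorem lintegral_exp_abs_mul_gaussianReal_le (v : ℝ≥0) (t : ℝ) :
    ∫⁻ x, ENNReal.ofReal (Real.exp (t * |x|)) ∂(gaussianReal 0 v)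
      ≤ 2 * ENNReal.ofReal (Real.exp (v * t ^ 2 / 2)) := by
  calc ∫⁻ x, ENNReal.ofReal (Real.exp (t * |x|)) ∂(gaussianReal 0 v)
      ≤ ∫⁻ x, (ENNReal.ofReal (Real.exp (t * x)) + ENNReal.ofReal (Real.exp (-t * x)))
          ∂(gaussianReal 0 v) := by
        refine lintegral_mono fun x => ?_
        rcases abs_choice x with h | h
        · rw [h]; exact le_self_add
        · rw [h, mul_neg, ← neg_mul]; exact le_add_self
    _ = 2 * ENNReal.ofReal (Real.exp (v * t ^ 2 / 2)) := by
        rw [lintegral_add_left (by fun_prop), lintegral_exp_mul_gaussianReal,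
          lintegral_exp_mul_gaussianReal, neg_sq, two_mul]

/-- The exact value is `1 / √3`, and `e ≤ 3`. -/
theorem lintegral_exp_neg_sq_div_gaussianReal_le {v : ℝ≥0} (hv : v ≠ 0) :
    ∫⁻ x, ENNReal.ofReal (Real.exp (-(x ^ 2 / v))) ∂(gaussianReal 0 v)
      ≤ ENNReal.ofReal (Real.exp (-(1 / 2))) := by
  have hv0 : (0 : ℝ) < v := by positivity
  have hint : Integrable (fun x : ℝ => Real.exp (-(x ^ 2 / v))) (gaussianReal 0 v) := by
    refine Integrable.of_bound (C := 1) (by fun_prop) (ae_of_all _ fun x => ?_)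
    rw [Real.norm_eq_abs, Real.abs_exp, Real.exp_le_one_iff]
    have : 0 ≤ x ^ 2 / (v : ℝ) := by positivity
    linarith
  rw [← ofReal_integral_eq_lintegral_ofReal hint (ae_of_all _ fun x => (Real.exp_pos _).le)]
  apply ENNReal.ofReal_le_ofReal
  rw [integral_gaussianReal_eq_integral_smul hv]
  have h1 : ∀ x : ℝ, gaussianPDFReal 0 v x • Real.exp (-(x ^ 2 / v))
      = (√(2 * Real.pi * v))⁻¹ * Real.exp (-(3 / (2 * v)) * x ^ 2) := by
    intro x
    rw [gaussianPDFReal, smul_eq_mul, mul_assoc, ← Real.exp_add]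
    congr 2
    field_simp
    ring
  simp_rw [h1]
  rw [integral_const_mul, integral_gaussian, ← Real.sqrt_inv, ← Real.sqrt_mul (by positivity),
    show (2 * Real.pi * (v : ℝ))⁻¹ * (Real.pi / (3 / (2 * v))) = 3⁻¹ by field_simp]
  rw [Real.sqrt_le_left (Real.exp_pos _).le, ← Real.exp_nat_mul,
    show ((2 : ℕ) : ℝ) * -(1 / 2) = -1 by norm_num, Real.exp_neg]
  exact inv_anti₀ (Real.exp_pos _) (Real.exp_one_lt_d9.le.trans (by norm_num))

end Gaussian

/-! ### The driving noise -/

section Noise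

variable {Ω : Type*} {F0 : MeasurableSpace Ω} {mΩ : MeasurableSpace Ω}
  {P : Measure Ω} {W : ℕ → ℝ≥0 → Ω → ℝ}

theorem filt_mono (F0 : MeasurableSpace Ω) (W : ℕ → ℝ≥0 → Ω → ℝ) : Monotone (filt F0 W) := by
  intro s t hst
  refine sup_le_sup_left (iSup_mono fun j => iSup_le fun u => iSup_le fun hu => ?_) _
  exact le_iSup₂_of_le u (hu.trans hst) le_rfl

theorem measurable_filt (F0 : MeasurableSpace Ω) (W : ℕ → ℝ≥0 → Ω → ℝ) (j : ℕ) {s t : ℝ≥0}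
    (h : s ≤ t) : Measurable[filt F0 W t] (W j s) := by
  rw [measurable_iff_comap_le]
  exact le_sup_of_le_right (le_iSup_of_le j (le_iSup₂_of_le s h le_rfl))

theorem DantzigDiffusion.IsDrivingNoise.filt_le (hW : IsDrivingNoise F0 P W) (t : ℝ≥0) :
    filt F0 W t ≤ mΩ :=
  sup_le hW.le (iSup_le fun j => iSup_le fun s => iSup_le fun _ => (hW.measurable j s).comap_le)

theorem DantzigDiffusion.IsDrivingNoise.map_sub (hW : IsDrivingNoise F0 P W) (j : ℕ)
    {s t : ℝ≥0} (h : s ≤ t) : P.map (fun ω => W j t ω - W j s ω) = gaussianReal 0 (t - s) := by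
  have h1 := ((hW.brownian j).hasLaw_sub t s).map_eq
  have h2 : nndist (t : ℝ) (s : ℝ) = t - s := by
    apply NNReal.eq
    rw [coe_nndist, Real.dist_eq, NNReal.coe_sub h, abs_of_nonneg]
    exact sub_nonneg.2 (NNReal.coe_le_coe.2 h)
  rw [← h2]
  exact h1

/-- The `σ`-field generated by the whole path of `W j`. -/
abbrev pathField (W : ℕ → ℝ≥0 → Ω → ℝ) (j : ℕ) : MeasurableSpace Ω :=
  MeasurableSpace.comap (fun ω (u : ℝ≥0) => W j u ω) MeasurableSpace.pi

/-- The `σ`-field generated by `W j` up to the time `s`. -/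
abbrev pastField (W : ℕ → ℝ≥0 → Ω → ℝ) (j : ℕ) (s : ℝ≥0) : MeasurableSpace Ω :=
  ⨆ (u : ℝ≥0) (_ : u ≤ s), MeasurableSpace.comap (W j u) inferInstance

/-- The `σ`-field generated by the increment of `W j` between `s` and `t`. -/
abbrev incrementField (W : ℕ → ℝ≥0 → Ω → ℝ) (j : ℕ) (s t : ℝ≥0) : MeasurableSpace Ω :=
  MeasurableSpace.comap (fun ω => W j t ω - W j s ω) inferInstance

/-- The `σ`-field generated by all the paths but the one of `W i`. -/
abbrev otherPathsField (W : ℕ → ℝ≥0 → Ω → ℝ) (i : ℕ) : MeasurableSpace Ω :=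
  ⨆ j ∈ ({i}ᶜ : Set ℕ), pathField W j

/-- The increment of `W i` after `s` is independent of the past of `W i`, this past together with
the increment is independent of the other paths, and all paths are independent of `F0`. -/
theorem DantzigDiffusion.IsDrivingNoise.indep_increment [IsProbabilityMeasure P]
    (hW : IsDrivingNoise F0 P W) (i : ℕ) {s t : ℝ≥0} (h : s ≤ t) :
    Indep (incrementField W i s t) (filt F0 W s) P := by
  have hpath_meas : ∀ j u, Measurable[pathField W j] (W j u) := fun j u =>
    (measurable_pi_apply u).comp (comap_measurable (fun ω (u : ℝ≥0) => W j u ω))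
  have hpath_le : ∀ j, pathField W j ≤ mΩ := fun j =>
    (measurable_pi_lambda _ fun u => hW.measurable j u).comap_le
  have hD_path : incrementField W i s t ≤ pathField W i := ((hpath_meas i t).sub (hpath_meas i s)).comap_le
  have hG_path : pastField W i s ≤ pathField W i := iSup₂_le fun u _ => (hpath_meas i u).comap_le
  have hDG : Indep (incrementField W i s t) (pastField W i s) P := by
    have hB := (hW.brownian i).indepFun_shift s
    rw [IndepFun_iff_Indep] at hB
    refine indep_of_indep_of_le_left (indep_of_indep_of_le_right hB ?_) ?_
    · refine iSup₂_le fun u hu => Measurable.comap_le ?_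
      exact (measurable_pi_apply (⟨u, hu⟩ : Set.Iic s)).comp
        (comap_measurable (fun ω (t : Set.Iic s) => W i t ω))
    · refine Measurable.comap_le ?_
      have := (measurable_pi_apply (t - s)).comp
        (comap_measurable (fun ω (u : ℝ≥0) => W i (s + u) ω - W i s ω))
      simpa only [Function.comp_def, add_tsub_cancel_of_le h] using this
  have hH : Indep (incrementField W i s t ⊔ pastField W i s) (otherPathsField W i) P := by
    have h1 := indep_iSup_of_disjoint hpath_le hW.indep
      (S := {i}) (T := {i}ᶜ) disjoint_compl_right
    exact indep_of_indep_of_le_left h1 (by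
      rw [iSup_singleton]; exact sup_le hD_path hG_path)
  have hall_le : ∀ j, pathField W j ≤ ⨆ (j : ℕ) (t : ℝ≥0), MeasurableSpace.comap (W j t) inferInstance := by
    intro j
    refine Measurable.comap_le ?_
    refine @measurable_pi_lambda _ _ _ (_) _ _ fun u => ?_
    rw [measurable_iff_comap_le]
    exact le_iSup₂_of_le j u le_rfl
  have hHle : otherPathsField W i ≤ mΩ := iSup₂_le fun j _ => hpath_le j
  have h1 : Indep (incrementField W i s t) (pastField W i s ⊔ otherPathsField W i) P := indep_sup_right_of_indep_sup
    (hD_path.trans (hpath_le i)) (hG_path.trans (hpath_le i)) hHle hDG hH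
  have h2 : Indep (incrementField W i s t ⊔ (pastField W i s ⊔ otherPathsField W i)) F0 P := by
    refine indep_of_indep_of_le_left hW.indep_F0.symm ?_
    exact sup_le (hD_path.trans (hall_le i)) (sup_le (hG_path.trans (hall_le i))
      (iSup₂_le fun j _ => hall_le j))
  have h3 := indep_sup_right_of_indep_sup (hD_path.trans (hpath_le i))
    (sup_le (hG_path.trans (hpath_le i)) hHle) hW.le h1 h2
  refine indep_of_indep_of_le_right h3 (sup_le le_sup_right (iSup_le fun j => ?_))
  refine le_sup_of_le_left ?_
  by_cases hj : j = i
  · subst hj; exact le_sup_left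
  · refine le_sup_of_le_right (iSup₂_le fun u _ => ?_)
    exact (hpath_meas j u).comap_le.trans (le_iSup₂_of_le j hj le_rfl)

end Noise

/-! ### Deviation bounds for the driving noise -/

section Deviation

variable {Ω : Type*} {F0 : MeasurableSpace Ω} {mΩ : MeasurableSpace Ω}
  {P : Measure Ω} {W : ℕ → ℝ≥0 → Ω → ℝ}

/-- The increment of `W i` over the `k`-th sampling interval. -/
def noiseIncr (W : ℕ → ℝ≥0 → Ω → ℝ) (Δ : ℝ≥0) (i k : ℕ) (ω : Ω) : ℝ :=
  W i ((k + 1 : ℕ) * Δ) ω - W i (k * Δ) ω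

theorem grid_mono (Δ : ℝ≥0) : Monotone fun k : ℕ => (k : ℝ≥0) * Δ := fun _ _ h =>
  mul_le_mul_left (Nat.cast_le.2 h) Δ

theorem grid_succ_sub (Δ : ℝ≥0) (k : ℕ) : ((k + 1 : ℕ) : ℝ≥0) * Δ - k * Δ = Δ := by
  push_cast
  rw [add_mul, one_mul, add_tsub_cancel_left]

/-- Exponential moments along the sampling grid: the increments are `N(0, Δ)` and independent of
the past. -/
theorem DantzigDiffusion.IsDrivingNoise.lintegral_prod_le [IsProbabilityMeasure P]
    (hW : IsDrivingNoise F0 P W) (Δ : ℝ≥0) (i : ℕ) {a : ℕ → Ω → ℝ}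
    (ha : ∀ k : ℕ, Measurable[filt F0 W (k * Δ)] (a k))
    {g : ℝ → ℝ → ℝ≥0∞} (hg : Measurable (Function.uncurry g)) {c : ℝ≥0∞}
    (hc : ∀ k ω, ∫⁻ x, g (a k ω) x ∂(gaussianReal 0 Δ) ≤ c) (n : ℕ) :
    ∫⁻ ω, ∏ k ∈ Finset.range n, g (a k ω) (noiseIncr W Δ i k ω) ∂P ≤ c ^ n := by
  refine lintegral_prod_comp_le_pow (G := fun k : ℕ => filt F0 W (k * Δ)) (fun k => hW.filt_le _)
    ((filt_mono F0 W).comp (grid_mono Δ)) ha (fun k => ?_) (fun k => ?_) hg (fun k ω => ?_) n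
  · exact (measurable_filt F0 W i le_rfl).sub (measurable_filt F0 W i (grid_mono Δ k.le_succ))
  · exact hW.indep_increment i (grid_mono Δ k.le_succ)
  · have := hW.map_sub i (grid_mono Δ k.le_succ)
    rw [grid_succ_sub] at this
    have h2 : P.map (noiseIncr W Δ i k) = gaussianReal 0 Δ := this
    rw [h2]
    exact hc k ω

theorem DantzigDiffusion.IsDrivingNoise.measurable_noiseIncr (hW : IsDrivingNoise F0 P W)
    (Δ : ℝ≥0) (i k : ℕ) : Measurable (noiseIncr W Δ i k) :=
  (hW.measurable i _).sub (hW.measurable i _)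

theorem measure_le_of_lintegral_exp_le {f : Ω → ℝ} (hf : Measurable f) {u c : ℝ}
    (h : ∫⁻ ω, ENNReal.ofReal (Real.exp (f ω)) ∂P ≤ ENNReal.ofReal (Real.exp c)) :
    P {ω | u ≤ f ω} ≤ ENNReal.ofReal (Real.exp (c - u)) := by
  have h1 := mul_meas_ge_le_lintegral₀ (μ := P) (f := fun ω => ENNReal.ofReal (Real.exp (f ω)))
    (by fun_prop) (ENNReal.ofReal (Real.exp u))
  have h2 : {ω | u ≤ f ω} ⊆
      {ω | ENNReal.ofReal (Real.exp u) ≤ ENNReal.ofReal (Real.exp (f ω))} := fun ω hω =>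
    ENNReal.ofReal_le_ofReal (Real.exp_le_exp.2 hω)
  have hu : 0 < Real.exp u := Real.exp_pos u
  rw [Real.exp_sub, ENNReal.ofReal_div_of_pos hu,
    ENNReal.le_div_iff_mul_le (Or.inl (by simpa using hu)) (Or.inl ENNReal.ofReal_ne_top),
    mul_comm]
  exact (mul_le_mul_right (measure_mono h2) _).trans (h1.trans h)

/-- Lower deviations of the realized quadratic variation, by the Laplace transform of the
`χ²` distribution at `-1`. -/
theorem DantzigDiffusion.IsDrivingNoise.measure_sum_sq_le [IsProbabilityMeasure P]
    (hW : IsDrivingNoise F0 P W) {Δ : ℝ≥0} (hΔ : 0 < Δ) (i n : ℕ) :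
    P {ω | ∑ k ∈ Finset.range n, noiseIncr W Δ i k ω ^ 2 ≤ n * Δ / 4}
      ≤ ENNReal.ofReal (Real.exp (-(n / 4 : ℝ))) := by
  have hΔ' : (0 : ℝ) < Δ := hΔ
  have h1 := hW.lintegral_prod_le Δ i (a := fun _ _ => 0) (fun k => measurable_const)
    (g := fun _ x => ENNReal.ofReal (Real.exp (-(x ^ 2 / Δ)))) (by fun_prop)
    (fun k ω => lintegral_exp_neg_sq_div_gaussianReal_le hΔ.ne') n
  have h2 := measure_le_of_lintegral_exp_le (P := P)
    (f := fun ω => ∑ k ∈ Finset.range n, -(noiseIncr W Δ i k ω ^ 2 / Δ)) (u := -(n / 4 : ℝ))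
    (c := -(n / 2 : ℝ))
    (Finset.measurable_fun_sum _ fun k _ =>
      (((hW.measurable_noiseIncr Δ i k).pow_const 2).div_const _).neg) (by
      simp_rw [Real.exp_sum]
      simp_rw [ENNReal.ofReal_prod_of_nonneg fun _ _ => (Real.exp_pos _).le]
      refine h1.trans_eq ?_
      rw [← ENNReal.ofReal_pow (Real.exp_pos _).le, ← Real.exp_nat_mul]
      congr 2; ring)
  refine (measure_mono fun ω hω => ?_).trans (h2.trans_eq (by congr 2; ring))
  simp only [Set.mem_ofPred_eq] at hω ⊢
  rw [Finset.sum_neg_distrib, ← Finset.sum_div, neg_le_neg_iff, div_le_iff₀ hΔ']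
  linarith

theorem DantzigDiffusion.IsDrivingNoise.measure_le_sum_mul [IsProbabilityMeasure P]
    (hW : IsDrivingNoise F0 P W) (Δ : ℝ≥0) (i n : ℕ) {a : ℕ → Ω → ℝ}
    (ha : ∀ k : ℕ, Measurable[filt F0 W (k * Δ)] (a k)) {L : ℝ} (hL : ∀ k ω, |a k ω| ≤ L)
    {t : ℝ} (ht : 0 ≤ t) (u : ℝ) :
    P {ω | u ≤ ∑ k ∈ Finset.range n, a k ω * noiseIncr W Δ i k ω}
      ≤ ENNReal.ofReal (Real.exp (n * Δ * (t * L) ^ 2 / 2 - t * u)) := by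
  have h1 := hW.lintegral_prod_le Δ i (a := fun k ω => t * a k ω) (fun k => (ha k).const_mul t)
    (g := fun b x => ENNReal.ofReal (Real.exp (b * x))) (by unfold Function.uncurry; fun_prop)
    (c := ENNReal.ofReal (Real.exp (Δ * (t * L) ^ 2 / 2)))
    (fun k ω => lintegral_exp_mul_gaussianReal_le (by
      rw [abs_mul, abs_of_nonneg ht]; exact mul_le_mul_of_nonneg_left (hL k ω) ht)) n
  have ha' : ∀ k, Measurable (a k) := fun k => (ha k).mono (hW.filt_le _) le_rfl
  have h2 := measure_le_of_lintegral_exp_le (P := P)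
    (f := fun ω => ∑ k ∈ Finset.range n, t * a k ω * noiseIncr W Δ i k ω) (u := t * u)
    (c := n * Δ * (t * L) ^ 2 / 2)
    (Finset.measurable_fun_sum _ fun k _ =>
      ((ha' k).const_mul t).mul (hW.measurable_noiseIncr Δ i k)) (by
      simp_rw [Real.exp_sum]
      simp_rw [ENNReal.ofReal_prod_of_nonneg fun _ _ => (Real.exp_pos _).le]
      refine h1.trans_eq ?_
      rw [← ENNReal.ofReal_pow (Real.exp_pos _).le, ← Real.exp_nat_mul]
      congr 2; ring)
  refine (measure_mono fun ω hω => ?_).trans h2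
  simp only [Set.mem_ofPred_eq, mul_assoc] at hω ⊢
  rw [← Finset.mul_sum]
  exact mul_le_mul_of_nonneg_left hω ht

/-- Deviations of the discretized stochastic integral of a bounded adapted integrand. -/
theorem DantzigDiffusion.IsDrivingNoise.measure_le_abs_sum_mul [IsProbabilityMeasure P]
    (hW : IsDrivingNoise F0 P W) (Δ : ℝ≥0) (i n : ℕ) {a : ℕ → Ω → ℝ}
    (ha : ∀ k : ℕ, Measurable[filt F0 W (k * Δ)] (a k)) {L : ℝ} (hL : ∀ k ω, |a k ω| ≤ L)
    {t : ℝ} (ht : 0 ≤ t) (u : ℝ) :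
    P {ω | u ≤ |∑ k ∈ Finset.range n, a k ω * noiseIncr W Δ i k ω|}
      ≤ 2 * ENNReal.ofReal (Real.exp (n * Δ * (t * L) ^ 2 / 2 - t * u)) := by
  have h1 := hW.measure_le_sum_mul Δ i n ha hL ht u
  have h2 := hW.measure_le_sum_mul Δ i n (a := fun k ω => -a k ω) (fun k => (ha k).neg)
    (L := L) (fun k ω => by rw [abs_neg]; exact hL k ω) ht u
  rw [two_mul]
  refine (measure_mono fun ω hω => ?_).trans ((measure_union_le _ _).trans (add_le_add h1 h2))
  rw [Set.mem_ofPred_eq] at hω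
  rcases le_abs.1 hω with h | h
  · exact Or.inl h
  · refine Or.inr ?_
    simpa [Finset.sum_neg_distrib] using h

/-- The total fluctuation of `W j` inside the sampling intervals. -/
noncomputable def noiseFluct (W : ℕ → ℝ≥0 → Ω → ℝ) (Δ : ℝ≥0) (n j : ℕ) (ω : Ω) : ℝ :=
  ∑ k ∈ Finset.range n, ∫ s in ((k : ℝ) * Δ)..((k + 1 : ℝ) * Δ),
    |W j s.toNNReal ω - W j (k * Δ) ω|

/-- With `y = |W_s - W_{t_k}| / √Δ`, the inequality `y ≤ m - 1 + exp (y - m)` shows that a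
fluctuation of size `m` on average forces `exp (y - m)` to be at least `1` on average; Markov's
inequality concludes. -/
theorem DantzigDiffusion.IsDrivingNoise.measure_le_noiseFluct [IsProbabilityMeasure P]
    (hW : IsDrivingNoise F0 P W) {Δ : ℝ≥0} (hΔ : 0 < Δ) (j : ℕ) {n : ℕ} (hn : 0 < n) (m : ℝ) :
    P {ω | n * Δ * √Δ * m ≤ noiseFluct W Δ n j ω} ≤ 2 * ENNReal.ofReal (Real.exp (1 / 2 - m)) := by
  have hΔ' : (0 : ℝ) < Δ := hΔ
  have hsq : 0 < √(Δ : ℝ) := Real.sqrt_pos.2 hΔ'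
  obtain ⟨N, hsub, hNm, hN⟩ := exists_measurable_superset_of_null (ae_iff.1 (hW.brownian j).cont)
  have hcont : ∀ ω ∉ N, Continuous fun t => W j t ω := fun ω hω => by
    by_contra h; exact hω (hsub h)
  -- a version of `W j` all of whose paths are continuous, hence jointly measurable
  let V : ℝ → Ω → ℝ := fun s => Nᶜ.indicator (W j s.toNNReal)
  have hVc : ∀ ω, Continuous fun s => V s ω := by
    intro ω
    by_cases h : ω ∈ N
    · have : (fun s => V s ω) = fun _ => 0 := by ext s; simp [V, h]
      rw [this]; exact continuous_const
    · have : (fun s => V s ω) = fun s : ℝ => W j s.toNNReal ω := by ext s; simp [V, h]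
      rw [this]; exact (hcont ω h).comp continuous_real_toNNReal
  have hVm : ∀ s, Measurable (V s) := fun s => (hW.measurable j _).indicator hNm.compl
  have hVj : Measurable (Function.uncurry V) :=
    measurable_uncurry_of_continuous_of_measurable hVc hVm
  let f : ℕ → ℝ → Ω → ℝ := fun k s ω => Real.exp (|V s ω - V (k * Δ) ω| / √Δ - m)
  have hfj : ∀ k, Measurable (Function.uncurry fun ω s => ENNReal.ofReal (f k s ω)) := by
    intro k
    have h1 : Measurable fun z : Ω × ℝ => V z.2 z.1 := hVj.comp measurable_swap
    have h2 : Measurable fun z : Ω × ℝ => V (k * Δ) z.1 := (hVm _).comp measurable_fst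
    exact ENNReal.measurable_ofReal.comp (Real.measurable_exp.comp
      (((measurable_norm.comp (h1.sub h2)).div_const _).sub_const m))
  have hfc : ∀ k ω, Continuous fun s => f k s ω := fun k ω => by
    have := hVc ω
    exact Real.continuous_exp.comp (((this.sub continuous_const).abs.div_const _).sub
      continuous_const)
  have hlen : ∀ k : ℕ, (k : ℝ) * Δ ≤ (k + 1) * Δ := fun k => by nlinarith
  let Z : Ω → ℝ≥0∞ := fun ω => ∑ k ∈ Finset.range n,
    ∫⁻ s in Set.Ioc ((k : ℝ) * Δ) ((k + 1) * Δ), ENNReal.ofReal (f k s ω)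
  have hZm : ∀ k : ℕ, Measurable fun ω =>
      ∫⁻ s in Set.Ioc ((k : ℝ) * Δ) ((k + 1) * Δ), ENNReal.ofReal (f k s ω) := fun k =>
    (hfj k).lintegral_prod_right'
  have hsubset : {ω | n * Δ * √Δ * m ≤ noiseFluct W Δ n j ω} ⊆
      N ∪ {ω | ENNReal.ofReal (n * Δ) ≤ Z ω} := by
    intro ω hω
    by_cases hωN : ω ∈ N
    · exact Or.inl hωN
    refine Or.inr ?_
    have hVW : ∀ s, V s ω = W j s.toNNReal ω := fun s => by simp [V, hωN]
    have hVk : ∀ k : ℕ, V (k * Δ) ω = W j (k * Δ) ω := fun k => by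
      rw [hVW]; congr 1
      rw [Real.toNNReal_mul (Nat.cast_nonneg k), Real.toNNReal_natCast, Real.toNNReal_coe]
    have hZ : Z ω = ENNReal.ofReal (∑ k ∈ Finset.range n,
        ∫ s in ((k : ℝ) * Δ)..((k + 1) * Δ), f k s ω) := by
      rw [ENNReal.ofReal_sum_of_nonneg fun k _ =>
        intervalIntegral.integral_nonneg (hlen k) fun s _ => (Real.exp_pos _).le]
      refine Finset.sum_congr rfl fun k _ => ?_
      rw [intervalIntegral.integral_of_le (hlen k), ofReal_integral_eq_lintegral_ofReal
        ((hfc k ω).integrableOn_Ioc) (ae_of_all _ fun s => (Real.exp_pos _).le)]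
    have hk : ∀ k : ℕ, (∫ s in ((k : ℝ) * Δ)..((k + 1) * Δ), |W j s.toNNReal ω - W j (k * Δ) ω|)
        ≤ √Δ * (Δ * (m - 1) + ∫ s in ((k : ℝ) * Δ)..((k + 1) * Δ), f k s ω) := by
      intro k
      have hc1 : Continuous fun s : ℝ => |W j s.toNNReal ω - W j (k * Δ) ω| := by
        have := hVc ω
        simp_rw [hVW] at this
        exact (this.sub continuous_const).abs
      calc (∫ s in ((k : ℝ) * Δ)..((k + 1) * Δ), |W j s.toNNReal ω - W j (k * Δ) ω|)
          ≤ ∫ s in ((k : ℝ) * Δ)..((k + 1) * Δ), √Δ * ((m - 1) + f k s ω) := by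
            refine intervalIntegral.integral_mono_on (hlen k) (hc1.intervalIntegrable _ _)
              ((continuous_const.mul (continuous_const.add (hfc k ω))).intervalIntegrable _ _)
              fun s _ => ?_
            have h3 := Real.add_one_le_exp (|V s ω - V (k * Δ) ω| / √Δ - m)
            have h4 : |V s ω - V (k * Δ) ω| / √Δ ≤ (m - 1) + f k s ω := by
              simp only [f]; linarith
            rw [div_le_iff₀ hsq, hVW, hVk] at h4
            rw [mul_comm √(Δ : ℝ)]; exact h4
        _ = √Δ * (Δ * (m - 1) + ∫ s in ((k : ℝ) * Δ)..((k + 1) * Δ), f k s ω) := by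
            rw [intervalIntegral.integral_const_mul, intervalIntegral.integral_add
              (by simp) ((hfc k ω).intervalIntegrable _ _), intervalIntegral.integral_const,
              smul_eq_mul]
            ring
    have hsum := Finset.sum_le_sum fun k (_ : k ∈ Finset.range n) => hk k
    rw [← Finset.mul_sum, Finset.sum_add_distrib, Finset.sum_const, Finset.card_range,
      nsmul_eq_mul] at hsum
    have h5 : √Δ * (n * Δ * m) ≤ √Δ * (n * (Δ * (m - 1)) + ∑ k ∈ Finset.range n,
        ∫ s in ((k : ℝ) * Δ)..((k + 1) * Δ), f k s ω) := by
      refine le_trans (le_of_eq (by ring)) (le_trans hω hsum)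
    have h6 := le_of_mul_le_mul_left h5 hsq
    change ENNReal.ofReal (n * Δ) ≤ Z ω
    rw [hZ]
    exact ENNReal.ofReal_le_ofReal (by linarith)
  have hmoment : ∀ k : ℕ, ∀ s ∈ Set.Ioc ((k : ℝ) * Δ) ((k + 1) * Δ),
      ∫⁻ ω, ENNReal.ofReal (f k s ω) ∂P ≤ 2 * ENNReal.ofReal (Real.exp (1 / 2 - m)) := by
    intro k s hs
    have hks : (k : ℝ≥0) * Δ ≤ s.toNNReal := by
      rw [Real.le_toNNReal_iff_coe_le ((by positivity : (0 : ℝ) ≤ k * Δ).trans hs.1.le)]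
      exact_mod_cast hs.1.le
    have hae : ∀ᵐ ω ∂P, ENNReal.ofReal (f k s ω) = ENNReal.ofReal (Real.exp (-m)) *
        ENNReal.ofReal (Real.exp ((√Δ)⁻¹ * |W j s.toNNReal ω - W j (k * Δ) ω|)) := by
      filter_upwards [measure_eq_zero_iff_ae_notMem.1 hN] with ω hω
      have hVW : ∀ s, V s ω = W j s.toNNReal ω := fun s => by simp [V, hω]
      have hVk : V (k * Δ) ω = W j (k * Δ) ω := by
        rw [hVW]; congr 1
        rw [Real.toNNReal_mul (Nat.cast_nonneg k), Real.toNNReal_natCast, Real.toNNReal_coe]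
      rw [← ENNReal.ofReal_mul (Real.exp_pos _).le, ← Real.exp_add]
      simp only [f, hVk, hVW s]
      congr 2; ring
    rw [lintegral_congr_ae hae, lintegral_const_mul _ (by
      have h1 := hW.measurable j s.toNNReal
      have h2 := hW.measurable j (k * Δ)
      fun_prop)]
    have hmap := lintegral_map (μ := P) (g := fun ω => W j s.toNNReal ω - W j (k * Δ) ω)
      (f := fun x : ℝ => ENNReal.ofReal (Real.exp ((√Δ)⁻¹ * |x|))) (by fun_prop)
      ((hW.measurable j _).sub (hW.measurable j _))
    rw [← hmap, hW.map_sub j hks]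
    calc _ ≤ ENNReal.ofReal (Real.exp (-m)) * (2 * ENNReal.ofReal (Real.exp (1 / 2))) := by
          gcongr
          refine (lintegral_exp_abs_mul_gaussianReal_le _ _).trans ?_
          gcongr
          have h7 : ((s.toNNReal - k * Δ : ℝ≥0) : ℝ) ≤ Δ := by
            rw [NNReal.coe_le_coe, tsub_le_iff_right, Real.toNNReal_le_iff_le_coe]
            push_cast
            linarith [hs.2]
          rw [inv_pow, Real.sq_sqrt hΔ'.le, ← div_eq_mul_inv]
          exact (div_le_one hΔ').2 h7
      _ = _ := by
          rw [mul_left_comm, ← ENNReal.ofReal_mul (Real.exp_pos _).le, ← Real.exp_add]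
          congr 3; ring
  have hEZ : ∫⁻ ω, Z ω ∂P ≤ ENNReal.ofReal (n * Δ) * (2 * ENNReal.ofReal (Real.exp (1 / 2 - m))) := by
    rw [lintegral_finsetSum _ fun k _ => hZm k]
    calc _ ≤ ∑ k ∈ Finset.range n,
          ENNReal.ofReal Δ * (2 * ENNReal.ofReal (Real.exp (1 / 2 - m))) := by
          refine Finset.sum_le_sum fun k _ => ?_
          rw [lintegral_lintegral_swap (hfj k).aemeasurable]
          refine (setLIntegral_mono' measurableSet_Ioc (hmoment k)).trans_eq ?_
          rw [setLIntegral_const, Real.volume_Ioc, mul_comm]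
          congr 2; ring
      _ = _ := by
          rw [Finset.sum_const, Finset.card_range, nsmul_eq_mul, ← mul_assoc,
            ENNReal.ofReal_mul (Nat.cast_nonneg n), ENNReal.ofReal_natCast]
  have hpos : (0 : ℝ) < n * Δ := by positivity
  have hmarkov := (mul_meas_ge_le_lintegral₀ (μ := P) (f := Z)
    (Finset.measurable_fun_sum _ fun k _ => hZm k).aemeasurable (ENNReal.ofReal (n * Δ))).trans hEZ
  have h8 := (ENNReal.mul_le_mul_iff_right (ENNReal.ofReal_pos.2 hpos).ne'
    ENNReal.ofReal_ne_top).1 hmarkov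
  refine (measure_mono hsubset).trans ((measure_union_le _ _).trans ?_)
  rw [hN, zero_add]
  exact h8

end Deviation

/-! ### The oracle inequality -/

section Oracle

variable {ι : Type*} [Fintype ι]

theorem l1On_nonneg {κ : Type*} (T : Finset κ) (v : κ → ℝ) : 0 ≤ l1On T v :=
  Finset.sum_nonneg fun _ _ => abs_nonneg _

theorem l1On_add_l1On_compl [DecidableEq ι] (T : Finset ι) (v : ι → ℝ) :
    l1On T v + l1On Tᶜ v = l1Norm v :=
  Finset.sum_add_sum_compl T _

theorem l1Norm_pos {v : ι → ℝ} (hv : v ≠ 0) : 0 < l1Norm v := by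
  obtain ⟨j, hj⟩ := Function.ne_iff.1 hv
  exact Finset.sum_pos' (fun _ _ => abs_nonneg _) ⟨j, Finset.mem_univ j, abs_pos.2 hj⟩

theorem mem_supp {v : ι → ℝ} {j : ι} : j ∈ supp v ↔ v j ≠ 0 := by
  simp [supp]

theorem mem_cone_iff [DecidableEq ι] {T : Finset ι} {h : ι → ℝ} :
    h ∈ cone T ↔ l1On Tᶜ h ≤ l1On T h := by
  rw [cone, Set.mem_ofPred_eq]
  -- only the decidability instances in the complement differ
  convert Iff.rfl

theorem l1Norm_le_of_mem_cone {T : Finset ι} {h : ι → ℝ} (hc : h ∈ cone T) :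
    l1Norm h ≤ 2 * l1On T h := by
  classical
  have h1 := l1On_add_l1On_compl T h
  have h2 : l1On Tᶜ h ≤ l1On T h := mem_cone_iff.1 hc
  linarith

theorem l1On_pos_of_mem_cone {T : Finset ι} {h : ι → ℝ} (hc : h ∈ cone T) (h0 : h ≠ 0) :
    0 < l1On T h := by
  linarith [l1Norm_le_of_mem_cone hc, l1Norm_pos h0]

theorem lqNorm_pos {q : ℝ} {v : ι → ℝ} (hv : v ≠ 0) : 0 < lqNorm q v := by
  obtain ⟨j, hj⟩ := Function.ne_iff.1 hv
  exact Real.rpow_pos_of_pos (Finset.sum_pos' (fun _ _ => Real.rpow_nonneg (abs_nonneg _) _)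
    ⟨j, Finset.mem_univ j, Real.rpow_pos_of_pos (abs_pos.2 hj) _⟩) _

theorem lqNorm_zero {q : ℝ} (hq : 1 ≤ q) : lqNorm q (0 : ι → ℝ) = 0 := by
  have hq0 : q ≠ 0 := by linarith
  simp [lqNorm, Real.zero_rpow hq0, Real.zero_rpow (inv_ne_zero hq0)]

theorem lqNorm_le_l1Norm {q : ℝ} (hq : 1 ≤ q) (v : ι → ℝ) : lqNorm q v ≤ l1Norm v := by
  have hn : 0 ≤ l1Norm v := Finset.sum_nonneg fun _ _ => abs_nonneg _
  have h1 : ∑ j, |v j| ^ q ≤ l1Norm v ^ q := by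
    have h2 : ∀ a : ℝ, 0 ≤ a → a ^ q = a * a ^ (q - 1) := fun a ha => by
      rw [← Real.rpow_one_add' ha (by linarith)]
      congr 1; ring
    rw [h2 _ hn]
    conv_rhs => rw [l1Norm, Finset.sum_mul]
    refine Finset.sum_le_sum fun j _ => ?_
    rw [h2 _ (abs_nonneg _)]
    refine mul_le_mul_of_nonneg_left ?_ (abs_nonneg _)
    exact Real.rpow_le_rpow (abs_nonneg _)
      (Finset.single_le_sum (f := fun j => |v j|) (fun _ _ => abs_nonneg _) (Finset.mem_univ j))
      (by linarith)
  calc lqNorm q v ≤ (l1Norm v ^ q) ^ (1 / q) :=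
        Real.rpow_le_rpow (Finset.sum_nonneg fun _ _ => Real.rpow_nonneg (abs_nonneg _) _) h1
          (by positivity)
    _ = l1Norm v := by
        rw [← Real.rpow_mul hn, mul_one_div_cancel (by linarith), Real.rpow_one]

/-- The score is affine with slope `-V`. -/
theorem mulVec_hessian_sub (φ : ι → ℝ → ℝ) (n : ℕ) {Δ : ℝ} (hΔ : Δ ≠ 0) (x : ℕ → ι → ℝ) (i : ι)
    (θ θ₀ : ι → ℝ) (j : ι) :
    (hessian φ n Δ x i).mulVec (θ - θ₀) j = score φ n Δ x i θ₀ j - score φ n Δ x i θ j := by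
  have h1 : 1 / (n * Δ * sigmaHatSq n Δ x i) * Δ = 1 / (n * sigmaHatSq n Δ x i) := by
    rw [mul_right_comm, one_div, mul_inv, mul_assoc, inv_mul_cancel₀ hΔ, mul_one, one_div]
  simp only [Matrix.mulVec, dotProduct, hessian, score, Matrix.of_apply]
  rw [← mul_sub, ← Finset.sum_sub_distrib, ← h1]
  simp_rw [Finset.mul_sum, Finset.sum_mul]
  rw [Finset.sum_comm]
  refine Finset.sum_congr rfl fun k _ => ?_
  have h2 : φ j (x k j) * (x (k + 1) i - x k i - (∑ l, θ₀ l * φ l (x k l)) * Δ)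
      - φ j (x k j) * (x (k + 1) i - x k i - (∑ l, θ l * φ l (x k l)) * Δ)
      = φ j (x k j) * Δ * ∑ l, (θ l - θ₀ l) * φ l (x k l) := by
    simp_rw [sub_mul, Finset.sum_sub_distrib]
    ring
  simp_rw [← Finset.sum_mul, ← mul_sub] at h2 ⊢
  rw [h2, Finset.mul_sum, Finset.mul_sum]
  refine Finset.sum_congr rfl fun l _ => ?_
  simp only [Pi.sub_apply]
  ring

/-- The error of an estimate with no larger `l_1` norm lies in the cone of the true support. -/
theorem sub_mem_cone_supp {θ θ₀ : ι → ℝ} (h : l1Norm θ ≤ l1Norm θ₀) : θ - θ₀ ∈ cone (supp θ₀) := by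
  classical
  have h1 := l1On_add_l1On_compl (supp θ₀) θ
  have h2 := l1On_add_l1On_compl (supp θ₀) θ₀
  have hz : ∀ j ∈ (supp θ₀)ᶜ, θ₀ j = 0 := fun j hj => by
    simpa [mem_supp] using hj
  have h3 : l1On (supp θ₀)ᶜ θ₀ = 0 := Finset.sum_eq_zero fun j hj => by rw [hz j hj, abs_zero]
  have h4 : l1On (supp θ₀)ᶜ (θ - θ₀) = l1On (supp θ₀)ᶜ θ :=
    Finset.sum_congr rfl fun j hj => by rw [Pi.sub_apply, hz j hj, sub_zero]
  have h5 : l1On (supp θ₀) θ₀ ≤ l1On (supp θ₀) θ + l1On (supp θ₀) (θ - θ₀) := by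
    rw [l1On, l1On, l1On, ← Finset.sum_add_distrib]
    refine Finset.sum_le_sum fun j _ => ?_
    have := abs_sub_abs_le_abs_sub (θ₀ j) (θ j)
    rw [Pi.sub_apply, abs_sub_comm (θ j)]
    linarith
  have h6 : l1On (supp θ₀)ᶜ (θ - θ₀) ≤ l1On (supp θ₀) (θ - θ₀) := by linarith
  exact mem_cone_iff.2 h6

/-- The basic inequality `hᵀ V h < 4 γ ‖h_T‖₁`, strict because the score at the true parameter is
strictly below the threshold. -/
theorem quad_hessian_lt {φ : ι → ℝ → ℝ} {n : ℕ} {Δ γ : ℝ} (hΔ : Δ ≠ 0) {x : ℕ → ι → ℝ} {i : ι}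
    {θ θ₀ : ι → ℝ} {T : Finset ι} (h₀ : ∀ j, |score φ n Δ x i θ₀ j| < γ)
    (hθ : θ ∈ feasible φ n Δ γ x i) (hne : θ - θ₀ ≠ 0) (hc : θ - θ₀ ∈ cone T) :
    quad (hessian φ n Δ x i) (θ - θ₀) < 4 * γ * l1On T (θ - θ₀) := by
  obtain ⟨j₀, hj₀⟩ := Function.ne_iff.1 hne
  have hγ : 0 < γ := (abs_nonneg _).trans_lt (h₀ j₀)
  have hV : ∀ j, |(hessian φ n Δ x i).mulVec (θ - θ₀) j| < 2 * γ := fun j => by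
    rw [mulVec_hessian_sub φ n hΔ]
    have h1 := abs_sub (score φ n Δ x i θ₀ j) (score φ n Δ x i θ j)
    have h2 : |score φ n Δ x i θ j| ≤ γ := hθ j
    linarith [h₀ j]
  have hle : ∀ j, (θ - θ₀) j * (hessian φ n Δ x i).mulVec (θ - θ₀) j
      ≤ |(θ - θ₀) j| * (2 * γ) := fun j =>
    (le_abs_self _).trans ((abs_mul _ _).trans_le
      (mul_le_mul_of_nonneg_left (hV j).le (abs_nonneg _)))
  have h3 : quad (hessian φ n Δ x i) (θ - θ₀) < l1Norm (θ - θ₀) * (2 * γ) := by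
    rw [quad, dotProduct, l1Norm, Finset.sum_mul]
    refine Finset.sum_lt_sum (fun j _ => hle j) ⟨j₀, Finset.mem_univ _, ?_⟩
    exact (le_abs_self _).trans_lt ((abs_mul _ _).trans_lt
      (mul_lt_mul_of_pos_left (hV j₀) (abs_pos.2 hj₀)))
  have h4 := mul_le_mul_of_nonneg_right (l1Norm_le_of_mem_cone hc) (by positivity : 0 ≤ 2 * γ)
  linarith

section Bounds

variable {φ : ι → ℝ → ℝ} {n : ℕ} {Δ γ : ℝ} {x : ℕ → ι → ℝ} {i : ι} {θ θ₀ : ι → ℝ} {S : ℕ}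

theorem DantzigDiffusion.IsDantzigSelector.sub_mem_cone
    (hθ : IsDantzigSelector φ n Δ γ x i θ) (h₀ : ∀ j, |score φ n Δ x i θ₀ j| < γ) :
    θ - θ₀ ∈ cone (supp θ₀) :=
  sub_mem_cone_supp (hθ.2 θ₀ fun j => (h₀ j).le)

/-- The square root sends a negative quadratic form to `0`, so its sign need not be known. -/
theorem sqrt_mul_sqrt_div_sq_mul_lt {s S Q l γ : ℝ} (hs : 0 ≤ s) (hsS : s ≤ S) (hS : 0 < S)
    (hl : 0 < l) (hγ : 0 < γ) (hQ : Q < 4 * γ * l) : (√s * √Q / l) ^ 2 * l < 4 * S * γ := by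
  have h1 : √Q ^ 2 < 4 * γ * l := by
    rcases le_total 0 Q with h | h
    · rwa [Real.sq_sqrt h]
    · rw [Real.sqrt_eq_zero_of_nonpos h, zero_pow two_ne_zero]; positivity
  have h3 : 0 < l * l := mul_pos hl hl
  rw [div_pow, mul_pow, Real.sq_sqrt hs, sq l, div_mul_eq_mul_div, div_lt_iff₀ h3]
  have h2 : s * √Q ^ 2 < S * (4 * γ * l) :=
    (mul_le_mul_of_nonneg_right hsS (sq_nonneg _)).trans_lt (mul_lt_mul_of_pos_left h1 hS)
  nlinarith

/-- Strictness for a vanishing error needs `K ≠ ⊤`; if `K = 0`, the right-hand side is `⊤`. -/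
theorem DantzigDiffusion.IsDantzigSelector.l1Norm_sub_lt (hΔ : Δ ≠ 0)
    (hθ : IsDantzigSelector φ n Δ γ x i θ) (h₀ : ∀ j, |score φ n Δ x i θ₀ j| < γ) (hγ : 0 < γ)
    (hS : 0 < S) (hcard : (supp θ₀).card ≤ S) {K : ℝ≥0∞} (hK : K ≠ ⊤)
    (hKle : K ≤ compatibilityFactor (supp θ₀) (hessian φ n Δ x i) ^ 2) :
    ENNReal.ofReal (l1Norm (θ - θ₀)) < ENNReal.ofReal (8 * S * γ) / K := by
  have hS' : (0 : ℝ) < S := Nat.cast_pos.2 hS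
  by_cases h0 : θ - θ₀ = 0
  · have : l1Norm (θ - θ₀) = 0 := by rw [h0]; simp [l1Norm]
    rw [this, ENNReal.ofReal_zero]
    exact ENNReal.div_pos (ENNReal.ofReal_pos.2 (by positivity)).ne' hK
  have hc := hθ.sub_mem_cone h₀
  have hl := l1On_pos_of_mem_cone hc h0
  have hQ := quad_hessian_lt hΔ h₀ hθ.1 h0 hc
  have hb := sqrt_mul_sqrt_div_sq_mul_lt (Nat.cast_nonneg _) (Nat.cast_le.2 hcard) hS' hl hγ hQ
  set r := √((supp θ₀).card : ℝ) * √(quad (hessian φ n Δ x i) (θ - θ₀)) / l1On (supp θ₀) (θ - θ₀)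
  have hKr : K ≤ ENNReal.ofReal (r ^ 2) := by
    rw [ENNReal.ofReal_pow (by positivity)]
    refine hKle.trans (pow_le_pow_left' ?_ 2)
    exact iInf_le_of_le (θ - θ₀) (iInf₂_le h0 hc)
  rw [ENNReal.lt_div_iff_mul_lt (Or.inr ENNReal.ofReal_ne_top) (Or.inl hK)]
  calc ENNReal.ofReal (l1Norm (θ - θ₀)) * K
      ≤ ENNReal.ofReal (l1Norm (θ - θ₀)) * ENNReal.ofReal (r ^ 2) := by gcongr
    _ = ENNReal.ofReal (l1Norm (θ - θ₀) * r ^ 2) := (ENNReal.ofReal_mul (l1Norm_pos h0).le).symm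
    _ < ENNReal.ofReal (8 * S * γ) := by
        refine (ENNReal.ofReal_lt_ofReal_iff (by positivity)).2 ?_
        have := mul_le_mul_of_nonneg_right (l1Norm_le_of_mem_cone hc) (sq_nonneg r)
        linarith

theorem DantzigDiffusion.IsDantzigSelector.l1Norm_sub_le (hΔ : Δ ≠ 0)
    (hθ : IsDantzigSelector φ n Δ γ x i θ) (h₀ : ∀ j, |score φ n Δ x i θ₀ j| < γ) (hγ : 0 < γ)
    (hS : 0 < S) (hcard : (supp θ₀).card ≤ S) {δ : ℝ} (hδ : 0 < δ)
    (hδκ : ENNReal.ofReal δ ≤ compatibilityFactor (supp θ₀) (hessian φ n Δ x i)) :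
    l1Norm (θ - θ₀) ≤ 8 * S * γ / δ ^ 2 := by
  have h1 := hθ.l1Norm_sub_lt hΔ h₀ hγ hS hcard (K := ENNReal.ofReal (δ ^ 2))
    ENNReal.ofReal_ne_top (by
      rw [ENNReal.ofReal_pow hδ.le]; exact pow_le_pow_left' hδκ 2)
  rw [← ENNReal.ofReal_div_of_pos (by positivity)] at h1
  exact (ENNReal.ofReal_lt_ofReal_iff_of_nonneg
    (Finset.sum_nonneg fun _ _ => abs_nonneg _)).1 h1 |>.le

theorem DantzigDiffusion.IsDantzigSelector.lqNorm_sub_lt (hΔ : Δ ≠ 0)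
    (hθ : IsDantzigSelector φ n Δ γ x i θ) (h₀ : ∀ j, |score φ n Δ x i θ₀ j| < γ) (hγ : 0 < γ)
    (hS : 0 < S) (hcard : (supp θ₀).card ≤ S) {q : ℝ} (hq : 1 ≤ q) {K : ℝ≥0∞} (hK : K ≠ ⊤)
    (hKle : K ≤ weakConeFactor q (supp θ₀) (hessian φ n Δ x i)) :
    ENNReal.ofReal (lqNorm q (θ - θ₀)) < ENNReal.ofReal (4 * (S : ℝ) ^ (1 / q) * γ) / K := by
  have hS' : (0 : ℝ) < S := Nat.cast_pos.2 hS
  by_cases h0 : θ - θ₀ = 0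
  · rw [h0, lqNorm_zero hq, ENNReal.ofReal_zero]
    exact ENNReal.div_pos (ENNReal.ofReal_pos.2 (by positivity)).ne' hK
  have hc := hθ.sub_mem_cone h₀
  have hl := l1On_pos_of_mem_cone hc h0
  have hQ := quad_hessian_lt hΔ h₀ hθ.1 h0 hc
  have hlq : 0 < lqNorm q (θ - θ₀) := lqNorm_pos h0
  set l := l1On (supp θ₀) (θ - θ₀)
  set Q := quad (hessian φ n Δ x i) (θ - θ₀)
  set m := lqNorm q (θ - θ₀)
  have hKr : K ≤ ENNReal.ofReal (((supp θ₀).card : ℝ) ^ (1 / q) * Q / (l * m)) :=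
    hKle.trans (iInf_le_of_le _ (iInf₂_le h0 hc))
  have hpow : ((supp θ₀).card : ℝ) ^ (1 / q) ≤ (S : ℝ) ^ (1 / q) :=
    Real.rpow_le_rpow (Nat.cast_nonneg _) (Nat.cast_le.2 hcard) (by positivity)
  have hpow0 : 0 ≤ ((supp θ₀).card : ℝ) ^ (1 / q) := by positivity
  have hSpos : 0 < (S : ℝ) ^ (1 / q) := by positivity
  rw [ENNReal.lt_div_iff_mul_lt (Or.inr ENNReal.ofReal_ne_top) (Or.inl hK)]
  calc ENNReal.ofReal m * K
      ≤ ENNReal.ofReal m * ENNReal.ofReal (((supp θ₀).card : ℝ) ^ (1 / q) * Q / (l * m)) := by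
        gcongr
    _ = ENNReal.ofReal (((supp θ₀).card : ℝ) ^ (1 / q) * Q / l) := by
        rw [← ENNReal.ofReal_mul hlq.le]
        congr 1; field_simp
    _ < ENNReal.ofReal (4 * (S : ℝ) ^ (1 / q) * γ) := by
        refine (ENNReal.ofReal_lt_ofReal_iff (by positivity)).2 ?_
        rw [div_lt_iff₀ hl]
        calc ((supp θ₀).card : ℝ) ^ (1 / q) * Q
            ≤ ((supp θ₀).card : ℝ) ^ (1 / q) * max Q 0 :=
              mul_le_mul_of_nonneg_left (le_max_left _ _) hpow0
          _ ≤ (S : ℝ) ^ (1 / q) * max Q 0 := mul_le_mul_of_nonneg_right hpow (le_max_right _ _)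
          _ < (S : ℝ) ^ (1 / q) * (4 * γ * l) :=
              mul_lt_mul_of_pos_left (max_lt hQ (by positivity)) hSpos
          _ = 4 * (S : ℝ) ^ (1 / q) * γ * l := by ring

end Bounds

/-- A coordinate vector of the support lies in the cone. -/
theorem compatibilityFactor_ne_top {T : Finset ι} (hT : T.Nonempty) (V : Matrix ι ι ℝ) :
    compatibilityFactor T V ≠ ⊤ ∧ ∀ q, weakConeFactor q T V ≠ ⊤ := by
  classical
  obtain ⟨j, hj⟩ := hT
  have h0 : (Pi.single j 1 : ι → ℝ) ≠ 0 := by simp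
  have hc : (Pi.single j 1 : ι → ℝ) ∈ cone T := by
    have h1 : l1On Tᶜ (Pi.single j 1 : ι → ℝ) = 0 := Finset.sum_eq_zero fun l hl => by
      have : l ≠ j := fun h => (Finset.mem_compl.1 hl) (h ▸ hj)
      rw [Pi.single_eq_of_ne this, abs_zero]
    have h2 : l1On Tᶜ (Pi.single j 1 : ι → ℝ) ≤ l1On T (Pi.single j 1 : ι → ℝ) := by
      rw [h1]; exact l1On_nonneg _ _
    exact mem_cone_iff.2 h2
  exact ⟨ne_top_of_le_ne_top ENNReal.ofReal_ne_top (iInf_le_of_le _ (iInf₂_le h0 hc)),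
    fun q => ne_top_of_le_ne_top ENNReal.ofReal_ne_top (iInf_le_of_le _ (iInf₂_le h0 hc))⟩

/-- As an infimum of continuous functions of the matrix, the factor is upper semicontinuous. -/
theorem measurable_compatibilityFactor (T : Finset ι) :
    Measurable fun V : ι → ι → ℝ => compatibilityFactor T (Matrix.of V) := by
  refine UpperSemicontinuous.measurable ?_
  refine upperSemicontinuous_iInf fun h => upperSemicontinuous_iInf fun _ =>
    upperSemicontinuous_iInf fun _ => Continuous.upperSemicontinuous ?_
  refine ENNReal.continuous_ofReal.comp ?_
  have : Continuous fun V : ι → ι → ℝ => quad (Matrix.of V) h := by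
    simp only [quad, dotProduct, Matrix.mulVec, Matrix.of_apply]
    fun_prop
  fun_prop

end Oracle

/-! ### Discretization of one path -/

section Path

theorem card_supp_row_le {Θ : ℕ → ℕ → ℝ} {S : ℕ} (hS : IsSparse Θ S) {d : ℕ} (i : Fin d) :
    (supp (row Θ i)).card ≤ S := by
  classical
  have h1 : ({j | Θ i j ≠ 0} : Set ℕ).encard ≤ S := hS.2.1 ⟨(i : ℕ), rfl⟩
  have h2 : (((supp (row Θ i)).map Fin.valEmbedding : Finset ℕ) : Set ℕ) ⊆ {j | Θ i j ≠ 0} := by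
    intro j hj
    simp only [Finset.coe_map, Set.mem_image, Finset.mem_coe] at hj
    obtain ⟨l, hl, rfl⟩ := hj
    have hne := mem_supp.1 hl
    exact hne
  have h3 := (Set.encard_le_encard h2).trans h1
  rw [Set.encard_coe_eq_coe_finsetCard, Finset.card_map] at h3
  exact_mod_cast h3

theorem sum_abs_row_mul_le {Θ : ℕ → ℕ → ℝ} {S : ℕ} (hS : IsSparse Θ S) {K : ℝ}
    (hΘ : ∀ i j, |Θ i j| < K) {d : ℕ} (i : Fin d) {b : Fin d → ℝ} {B : ℝ} (hb : ∀ j, b j ≤ B)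
    (hB : 0 ≤ B) : ∑ j : Fin d, |Θ i j| * b j ≤ S * K * B := by
  have hK : 0 ≤ K := (abs_nonneg _).trans (hΘ 0 0).le
  calc ∑ j : Fin d, |Θ i j| * b j = ∑ j ∈ supp (row Θ i), |Θ i j| * b j := by
        refine (Finset.sum_subset (Finset.subset_univ _) fun j _ hj => ?_).symm
        have : Θ i j = 0 := not_not.1 fun hne => hj (mem_supp.2 hne)
        rw [this, abs_zero, zero_mul]
    _ ≤ ∑ j ∈ supp (row Θ i), K * B := by
        refine Finset.sum_le_sum fun j _ => ?_
        exact (mul_le_mul_of_nonneg_left (hb j) (abs_nonneg _)).trans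
          (mul_le_mul_of_nonneg_right (hΘ i j).le hB)
    _ ≤ S * K * B := by
        rw [Finset.sum_const, nsmul_eq_mul, mul_assoc]
        exact mul_le_mul_of_nonneg_right (Nat.cast_le.2 (card_supp_row_le hS i)) (by positivity)

/-- One path `x` of the equation, driven by the path `w`, together with the constants of the
regularity conditions. -/
structure IsPath (Θ : ℕ → ℕ → ℝ) (σ : ℕ → ℝ) (φ : ℕ → ℝ → ℝ) (S : ℕ) (L L' K₁ K₃ : ℝ) {d : ℕ}
    (x : ℝ≥0 → Fin d → ℝ) (w : ℕ → ℝ≥0 → ℝ) : Prop where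
  sparse : IsSparse Θ S
  bounded : ∀ j y, |φ j y| ≤ L
  lipschitz : ∀ j y z, |φ j y - φ j z| ≤ L' * |y - z|
  lipschitz_pos : 0 < L'
  drift : ∀ i j, |Θ i j| < K₁
  diff : ∀ i, |σ i| < K₃
  cont : Continuous x
  noise_cont : ∀ j, Continuous (w j)
  eqn : ∀ (i : Fin d) (t : ℝ≥0), x t i = x 0 i
      + (∫ s in (0 : ℝ)..t, ∑ j : Fin d, Θ i j * φ j (x s.toNNReal j)) + σ i * w i t

theorem continuous_of_abs_sub_le {f : ℝ → ℝ} {K : ℝ} (hK : 0 < K)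
    (h : ∀ y z, |f y - f z| ≤ K * |y - z|) : Continuous f :=
  (LipschitzWith.of_dist_le_mul (K := K.toNNReal) fun y z => by
    rw [Real.coe_toNNReal _ hK.le]; exact h y z).continuous

namespace IsPath

variable {Θ : ℕ → ℕ → ℝ} {σ : ℕ → ℝ} {φ : ℕ → ℝ → ℝ} {S : ℕ} {L L' K₁ K₃ : ℝ} {d : ℕ}
  {x : ℝ≥0 → Fin d → ℝ} {w : ℕ → ℝ≥0 → ℝ}

theorem L_nonneg (h : IsPath Θ σ φ S L L' K₁ K₃ x w) : 0 ≤ L :=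
  (abs_nonneg _).trans (h.bounded 0 0)

theorem K₁_nonneg (h : IsPath Θ σ φ S L L' K₁ K₃ x w) : 0 ≤ K₁ :=
  (abs_nonneg _).trans (h.drift 0 0).le

theorem K₃_nonneg (h : IsPath Θ σ φ S L L' K₁ K₃ x w) : 0 ≤ K₃ :=
  (abs_nonneg _).trans (h.diff 0).le

theorem continuous_coord (h : IsPath Θ σ φ S L L' K₁ K₃ x w) (j : Fin d) :
    Continuous fun s : ℝ => x s.toNNReal j :=
  (continuous_apply j).comp (h.cont.comp continuous_real_toNNReal)

theorem continuous_phi_coord (h : IsPath Θ σ φ S L L' K₁ K₃ x w) (j : Fin d) :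
    Continuous fun s : ℝ => φ j (x s.toNNReal j) :=
  (continuous_of_abs_sub_le h.lipschitz_pos (h.lipschitz j)).comp (h.continuous_coord j)

theorem continuous_drift (h : IsPath Θ σ φ S L L' K₁ K₃ x w) (i : Fin d) :
    Continuous fun s : ℝ => ∑ j : Fin d, Θ i j * φ j (x s.toNNReal j) :=
  continuous_finsetSum _ fun j _ => continuous_const.mul (h.continuous_phi_coord j)

theorem abs_drift_le (h : IsPath Θ σ φ S L L' K₁ K₃ x w) (i : Fin d) (y : Fin d → ℝ) :
    |∑ j : Fin d, Θ i j * φ j (y j)| ≤ S * K₁ * L := by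
  refine (Finset.abs_sum_le_sum_abs _ _).trans ?_
  simp_rw [abs_mul]
  exact sum_abs_row_mul_le h.sparse h.drift i (fun j => h.bounded _ _) h.L_nonneg

theorem sub_eq (h : IsPath Θ σ φ S L L' K₁ K₃ x w) (i : Fin d) (s t : ℝ≥0) :
    x t i - x s i = (∫ r in (s : ℝ)..t, ∑ j : Fin d, Θ i j * φ j (x r.toNNReal j))
      + σ i * (w i t - w i s) := by
  have hint := fun a b : ℝ => (h.continuous_drift i).intervalIntegrable (μ := volume) a b
  rw [h.eqn i t, h.eqn i s, ← intervalIntegral.integral_add_adjacent_intervals (hint 0 s)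
    (hint s t)]
  ring

theorem abs_integral_drift_le (h : IsPath Θ σ φ S L L' K₁ K₃ x w) (i : Fin d) {s t : ℝ}
    (hst : s ≤ t) :
    |∫ r in s..t, ∑ j : Fin d, Θ i j * φ j (x r.toNNReal j)| ≤ S * K₁ * L * (t - s) := by
  have := intervalIntegral.norm_integral_le_of_norm_le_const (a := s) (b := t)
    (f := fun r => ∑ j : Fin d, Θ i j * φ j (x r.toNNReal j)) (C := S * K₁ * L)
    fun r _ => h.abs_drift_le i (x r.toNNReal)
  rwa [Real.norm_eq_abs, abs_of_nonneg (sub_nonneg.2 hst)] at this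

theorem abs_sub_le (h : IsPath Θ σ φ S L L' K₁ K₃ x w) (i : Fin d) {s t : ℝ≥0} (hst : s ≤ t) :
    |x t i - x s i| ≤ S * K₁ * L * (t - s) + K₃ * |w i t - w i s| := by
  rw [h.sub_eq i s t]
  refine (abs_add_le _ _).trans (add_le_add (h.abs_integral_drift_le i (NNReal.coe_le_coe.2 hst)) ?_)
  rw [abs_mul]
  exact mul_le_mul_of_nonneg_right (h.diff i).le (abs_nonneg _)

/-- The realized quadratic variation of the noise bounds `σ̂²` from below. -/
theorem le_sigmaHatSq (h : IsPath Θ σ φ S L L' K₁ K₃ x w) {Δ : ℝ≥0} (hΔ : 0 < Δ) {n : ℕ}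
    (hn : 0 < n) {K₄ : ℝ} (hK₄ : 0 ≤ K₄) (hσ : ∀ i, K₄ < |σ i|) (i : Fin d)
    (hw : n * Δ / 4 ≤ ∑ k ∈ Finset.range n, (w i ((k + 1 : ℕ) * Δ) - w i (k * Δ)) ^ 2) :
    K₄ ^ 2 / 8 - (S * K₁ * L) ^ 2 * Δ ≤ sigmaHatSq n Δ (fun k => x (k * Δ)) i := by
  have hΔ' : (0 : ℝ) < Δ := hΔ
  have hn' : (0 : ℝ) < n := Nat.cast_pos.2 hn
  have hk : ∀ k : ℕ, K₄ ^ 2 / 2 * (w i ((k + 1 : ℕ) * Δ) - w i (k * Δ)) ^ 2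
      - (S * K₁ * L * Δ) ^ 2 ≤ (x ((k + 1 : ℕ) * Δ) i - x (k * Δ) i) ^ 2 := by
    intro k
    have hle : (k : ℝ≥0) * Δ ≤ (k + 1 : ℕ) * Δ := grid_mono Δ k.le_succ
    have h1 := h.abs_integral_drift_le i (NNReal.coe_le_coe.2 hle)
    have h2 : (((k + 1 : ℕ) * Δ : ℝ≥0) : ℝ) - ((k * Δ : ℝ≥0) : ℝ) = Δ := by push_cast; ring
    rw [h2] at h1
    rw [h.sub_eq i (k * Δ) ((k + 1 : ℕ) * Δ)]
    have h3 := sq_le_sq' (abs_le.1 h1).1 (abs_le.1 h1).2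
    have h4 : K₄ ^ 2 ≤ σ i ^ 2 := by
      rw [← sq_abs (σ i)]; exact pow_le_pow_left₀ hK₄ (hσ i).le 2
    have h5 := mul_le_mul_of_nonneg_right h4 (sq_nonneg (w i ((k + 1 : ℕ) * Δ) - w i (k * Δ)))
    generalize (∫ r in _.._, ∑ j : Fin d, Θ i j * φ j (x r.toNNReal j)) = D at h3 ⊢
    generalize w i ((k + 1 : ℕ) * Δ) - w i (k * Δ) = b at h5 ⊢
    -- `(D + σ b)² ≥ (σ b)² / 2 - D²`
    nlinarith [sq_nonneg (2 * D + σ i * b)]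
  have hsum := Finset.sum_le_sum fun k (_ : k ∈ Finset.range n) => hk k
  rw [Finset.sum_sub_distrib, ← Finset.mul_sum, Finset.sum_const, Finset.card_range,
    nsmul_eq_mul] at hsum
  have h6 := mul_le_mul_of_nonneg_left hw (by positivity : 0 ≤ K₄ ^ 2 / 2)
  rw [sigmaHatSq, one_div, inv_mul_eq_div, le_div_iff₀ (by positivity)]
  calc _ = K₄ ^ 2 / 2 * (n * Δ / 4) - n * (S * K₁ * L * Δ) ^ 2 := by ring
    _ ≤ _ := by linarith

/-- The error made by freezing the drift at the left end of a sampling interval. -/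
theorem abs_integral_drift_sub_le (h : IsPath Θ σ φ S L L' K₁ K₃ x w) (Δ : ℝ≥0) (i : Fin d)
    (k : ℕ) :
    |(∫ r in ((k : ℝ) * Δ)..((k + 1 : ℝ) * Δ), ∑ j : Fin d, Θ i j * φ j (x r.toNNReal j))
        - (∑ j : Fin d, Θ i j * φ j (x (k * Δ) j)) * Δ|
      ≤ ∑ j : Fin d, |Θ i j| * (L' * (S * K₁ * L * Δ ^ 2
        + K₃ * ∫ r in ((k : ℝ) * Δ)..((k + 1 : ℝ) * Δ), |w j r.toNNReal - w j (k * Δ)|)) := by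
  have hle : (k : ℝ) * Δ ≤ (k + 1) * Δ := by nlinarith [Δ.coe_nonneg]
  have hlen : ((k + 1 : ℝ) * Δ) - k * Δ = Δ := by ring
  have hc : ∀ j : Fin d, Continuous fun r : ℝ => φ j (x r.toNNReal j) - φ j (x (k * Δ) j) :=
    fun j => (h.continuous_phi_coord j).sub continuous_const
  have hw : ∀ j : Fin d, Continuous fun r : ℝ => |w j r.toNNReal - w j (k * Δ)| := fun j =>
    (((h.noise_cont j).comp continuous_real_toNNReal).sub continuous_const).abs
  have h1 : (∫ r in ((k : ℝ) * Δ)..((k + 1 : ℝ) * Δ), ∑ j : Fin d, Θ i j * φ j (x r.toNNReal j))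
        - (∑ j : Fin d, Θ i j * φ j (x (k * Δ) j)) * Δ
      = ∑ j : Fin d, Θ i j * ∫ r in ((k : ℝ) * Δ)..((k + 1 : ℝ) * Δ),
        (φ j (x r.toNNReal j) - φ j (x (k * Δ) j)) := by
    have hi : ∀ j ∈ (Finset.univ : Finset (Fin d)), IntervalIntegrable
        (fun r : ℝ => Θ i j * φ j (x r.toNNReal j)) volume (k * Δ) ((k + 1) * Δ) := fun j _ =>
      (continuous_const.mul (h.continuous_phi_coord j)).intervalIntegrable _ _
    rw [intervalIntegral.integral_finsetSum hi, Finset.sum_mul,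
      ← Finset.sum_sub_distrib]
    refine Finset.sum_congr rfl fun j _ => ?_
    rw [intervalIntegral.integral_sub ((h.continuous_phi_coord j).intervalIntegrable _ _)
      (by simp), intervalIntegral.integral_const_mul, intervalIntegral.integral_const, hlen,
      smul_eq_mul]
    ring
  rw [h1]
  refine (Finset.abs_sum_le_sum_abs _ _).trans (Finset.sum_le_sum fun j _ => ?_)
  rw [abs_mul]
  refine mul_le_mul_of_nonneg_left ?_ (abs_nonneg _)
  refine (intervalIntegral.abs_integral_le_integral_abs hle).trans ?_
  have h2 : (∫ r in ((k : ℝ) * Δ)..((k + 1 : ℝ) * Δ), |φ j (x r.toNNReal j) - φ j (x (k * Δ) j)|)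
      ≤ ∫ r in ((k : ℝ) * Δ)..((k + 1 : ℝ) * Δ),
        L' * (S * K₁ * L * Δ + K₃ * |w j r.toNNReal - w j (k * Δ)|) := by
    refine intervalIntegral.integral_mono_on hle ((hc j).abs.intervalIntegrable _ _)
      ((continuous_const.mul (continuous_const.add
        (continuous_const.mul (hw j)))).intervalIntegrable _ _) fun r hr => ?_
    refine (h.lipschitz j _ _).trans (mul_le_mul_of_nonneg_left ?_ h.lipschitz_pos.le)
    have hr0 : 0 ≤ r := (by positivity : (0 : ℝ) ≤ k * Δ).trans hr.1
    have hkr : (k : ℝ≥0) * Δ ≤ r.toNNReal := by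
      rw [Real.le_toNNReal_iff_coe_le hr0]
      exact_mod_cast hr.1
    refine (h.abs_sub_le j hkr).trans (add_le_add_left ?_ _)
    refine mul_le_mul_of_nonneg_left ?_
      (mul_nonneg (mul_nonneg (Nat.cast_nonneg _) h.K₁_nonneg) h.L_nonneg)
    rw [Real.coe_toNNReal _ hr0]
    push_cast
    linarith [hr.2]
  refine h2.trans_eq ?_
  have hi : IntervalIntegrable (fun r : ℝ => K₃ * |w j r.toNNReal - w j (k * Δ)|) volume
      (k * Δ) ((k + 1) * Δ) := (continuous_const.mul (hw j)).intervalIntegrable _ _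
  rw [intervalIntegral.integral_const_mul, intervalIntegral.integral_add (by simp) hi, intervalIntegral.integral_const, hlen,
    intervalIntegral.integral_const_mul, smul_eq_mul]
  ring

/-- The score at the true row is a discretized stochastic integral plus a discretization error. -/
theorem abs_score_row_le (h : IsPath Θ σ φ S L L' K₁ K₃ x w) {Δ : ℝ≥0} (n : ℕ) (i j : Fin d)
    {c M F : ℝ} (hc : 0 < c) (hΔ : 0 < Δ) (hn : 0 < n)
    (hσ : c ≤ sigmaHatSq n Δ (fun k => x (k * Δ)) i) (hF₀ : 0 ≤ F)
    (hM : |∑ k ∈ Finset.range n,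
      φ j (x (k * Δ) j) * (w i ((k + 1 : ℕ) * Δ) - w i (k * Δ))| ≤ M)
    (hF : ∀ l : Fin d, ∑ k ∈ Finset.range n,
      ∫ r in ((k : ℝ) * Δ)..((k + 1 : ℝ) * Δ), |w l r.toNNReal - w l (k * Δ)| ≤ F) :
    |score (fun j : Fin d => φ j) n Δ (fun k => x (k * Δ)) i (row Θ i) j|
      ≤ 1 / (n * Δ * c) * (K₃ * M
        + L * (S * K₁ * (L' * (S * K₁ * L * n * Δ ^ 2 + K₃ * F)))) := by
  have hΔ' : (0 : ℝ) < Δ := hΔ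
  have hn' : (0 : ℝ) < n := Nat.cast_pos.2 hn
  let R : ℕ → ℝ := fun k =>
    (∫ r in ((k : ℝ) * Δ)..((k + 1 : ℝ) * Δ), ∑ j : Fin d, Θ i j * φ j (x r.toNNReal j))
        - (∑ j : Fin d, Θ i j * φ j (x (k * Δ) j)) * Δ
  have hinc : ∀ k : ℕ, x ((k + 1 : ℕ) * Δ) i - x (k * Δ) i
      - (∑ l, row Θ i l * φ l (x (k * Δ) l)) * Δ
      = σ i * (w i ((k + 1 : ℕ) * Δ) - w i (k * Δ)) + R k := by
    intro k
    have h1 := h.sub_eq i (k * Δ) ((k + 1 : ℕ) * Δ)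
    push_cast at h1 ⊢
    rw [h1]
    simp only [R, row]
    ring
  have hR : ∑ k ∈ Finset.range n, |R k| ≤ S * K₁ * (L' * (S * K₁ * L * n * Δ ^ 2 + K₃ * F)) := by
    refine (Finset.sum_le_sum fun k _ => h.abs_integral_drift_sub_le Δ i k).trans ?_
    rw [Finset.sum_comm]
    simp_rw [← Finset.mul_sum]
    have hK₁ := h.K₁_nonneg
    have hL := h.L_nonneg
    have hL' := h.lipschitz_pos
    have hK₃ := h.K₃_nonneg
    refine sum_abs_row_mul_le h.sparse h.drift i (fun l => ?_) (by positivity)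
    refine mul_le_mul_of_nonneg_left ?_ hL'.le
    rw [Finset.sum_add_distrib, Finset.sum_const, Finset.card_range, nsmul_eq_mul, ← Finset.mul_sum]
    refine add_le_add (le_of_eq (by ring)) (mul_le_mul_of_nonneg_left (hF l) hK₃)
  have hsum : |∑ k ∈ Finset.range n, φ j (x (k * Δ) j) * (x ((k + 1 : ℕ) * Δ) i - x (k * Δ) i
      - (∑ l, row Θ i l * φ l (x (k * Δ) l)) * Δ)|
      ≤ K₃ * M + L * (S * K₁ * (L' * (S * K₁ * L * n * Δ ^ 2 + K₃ * F))) := by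
    have h2 : ∑ k ∈ Finset.range n, φ j (x (k * Δ) j) * (x ((k + 1 : ℕ) * Δ) i - x (k * Δ) i
        - (∑ l, row Θ i l * φ l (x (k * Δ) l)) * Δ)
        = σ i * ∑ k ∈ Finset.range n,
            φ j (x (k * Δ) j) * (w i ((k + 1 : ℕ) * Δ) - w i (k * Δ))
          + ∑ k ∈ Finset.range n, φ j (x (k * Δ) j) * R k := by
      rw [Finset.mul_sum, ← Finset.sum_add_distrib]
      refine Finset.sum_congr rfl fun k _ => ?_
      rw [hinc]
      ring
    rw [h2]
    refine (abs_add_le _ _).trans (add_le_add ?_ ?_)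
    · rw [abs_mul]
      exact mul_le_mul (h.diff i).le hM (abs_nonneg _) h.K₃_nonneg
    · refine (Finset.abs_sum_le_sum_abs _ _).trans (le_trans ?_
        (mul_le_mul_of_nonneg_left hR h.L_nonneg))
      rw [Finset.mul_sum]
      refine Finset.sum_le_sum fun k _ => ?_
      rw [abs_mul]
      exact mul_le_mul_of_nonneg_right (h.bounded _ _) (abs_nonneg _)
  have hσ0 : 0 < sigmaHatSq n Δ (fun k => x (k * Δ)) i := hc.trans_le hσ
  rw [score, abs_mul, abs_of_pos (by positivity)]
  refine mul_le_mul ?_ hsum (abs_nonneg _) (by positivity)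
  exact one_div_le_one_div_of_le (by positivity) (mul_le_mul_of_nonneg_left hσ (by positivity))

end IsPath

end Path

/-! ### The true rows are strictly feasible with high probability -/

section Feasibility

variable {Ω : Type*} {F0 : MeasurableSpace Ω} {mΩ : MeasurableSpace Ω}
  {P : Measure Ω} {W : ℕ → ℝ≥0 → Ω → ℝ} {Θ : ℕ → ℕ → ℝ} {σ : ℕ → ℝ} {φ : ℕ → ℝ → ℝ} {S d : ℕ}
  {X : ℝ≥0 → Ω → Fin d → ℝ}

theorem measure_iUnion_fin_le {d : ℕ} {s : Fin d → Set Ω} {c : ℝ≥0∞} (h : ∀ i, P (s i) ≤ c) :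
    P (⋃ i, s i) ≤ d * c := by
  refine (measure_iUnion_fintype_le P s).trans ((Finset.sum_le_sum fun i _ => h i).trans_eq ?_)
  rw [Finset.sum_const, Finset.card_univ, Fintype.card_fin, nsmul_eq_mul]

/-- Non-asymptotic control of the scores at the true rows: union bound over the deviations of the
quadratic variations, of the stochastic integrals and of the fluctuations of the noise. -/
theorem measure_exists_le_abs_score_le [IsProbabilityMeasure P] (hW : IsDrivingNoise F0 P W)
    (hX : IsSolution F0 P W Θ σ φ d X) (hS : IsSparse Θ S) {L L' K₁ K₃ K₄ : ℝ}
    (hL : ∀ j x, |φ j x| ≤ L) (hL'0 : 0 < L') (hL' : ∀ j x y, |φ j x - φ j y| ≤ L' * |x - y|)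
    (hK₁ : ∀ i j, |Θ i j| < K₁) (hK₃ : ∀ i, |σ i| < K₃) (hK₄0 : 0 < K₄) (hK₄ : ∀ i, K₄ < |σ i|)
    {n : ℕ} (hn : 0 < n) {Δ : ℝ≥0} (hΔ : 0 < Δ) {t u m γ : ℝ} (ht : 0 ≤ t) (hm : 0 ≤ m)
    (hsmall : (S * K₁ * L) ^ 2 * Δ ≤ K₄ ^ 2 / 16)
    (hγ : 1 / (n * Δ * (K₄ ^ 2 / 16)) * (K₃ * u
        + L * (S * K₁ * (L' * (S * K₁ * L * n * Δ ^ 2 + K₃ * (n * Δ * √Δ * m))))) < γ) :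
    P {ω | ∃ i j, γ ≤ |score (fun j : Fin d => φ j) n Δ (sample Δ X ω) i (row Θ i) j|}
      ≤ ENNReal.ofReal (d * Real.exp (-(n / 4 : ℝ))
        + d * (d * (2 * Real.exp (n * Δ * (t * L) ^ 2 / 2 - t * u)))
        + d * (2 * Real.exp (1 / 2 - m))) := by
  have hpath : ∀ᵐ ω ∂P, IsPath Θ σ φ S L L' K₁ K₃ (fun t => X t ω) (fun j t => W j t ω) := by
    filter_upwards [hX.cont, hX.eqn, ae_all_iff.2 fun j => (hW.brownian j).cont] with ω h1 h2 h3
    exact ⟨hS, hL, hL', hL'0, hK₁, hK₃, h1, h3, h2⟩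
  let A : Fin d → Set Ω := fun i =>
    {ω | ∑ k ∈ Finset.range n, noiseIncr W Δ i k ω ^ 2 ≤ n * Δ / 4}
  let B : Fin d → Fin d → Set Ω := fun i j =>
    {ω | u ≤ |∑ k ∈ Finset.range n, φ j (X (k * Δ) ω j) * noiseIncr W Δ i k ω|}
  let C : Fin d → Set Ω := fun l => {ω | n * Δ * √Δ * m ≤ noiseFluct W Δ n l ω}
  have hA : ∀ i, P (A i) ≤ ENNReal.ofReal (Real.exp (-(n / 4 : ℝ))) := fun i =>
    hW.measure_sum_sq_le hΔ i n
  have hB : ∀ i j, P (B i j) ≤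
      2 * ENNReal.ofReal (Real.exp (n * Δ * (t * L) ^ 2 / 2 - t * u)) := fun i j =>
    hW.measure_le_abs_sum_mul Δ i n (a := fun k ω => φ j (X (k * Δ) ω j))
      (fun k => (continuous_of_abs_sub_le hL'0 (hL' j)).measurable.comp (hX.adapted _ j))
      (fun k ω => hL _ _) ht u
  have hC : ∀ l, P (C l) ≤ 2 * ENNReal.ofReal (Real.exp (1 / 2 - m)) := fun l =>
    hW.measure_le_noiseFluct hΔ l hn m
  have hsub : {ω | ∃ i j, γ ≤ |score (fun j : Fin d => φ j) n Δ (sample Δ X ω) i (row Θ i) j|}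
      ≤ᵐ[P] ((⋃ i, A i) ∪ (⋃ i, ⋃ j, B i j) ∪ ⋃ l, C l : Set Ω) := by
    filter_upwards [hpath] with ω hω ⟨i, j, hij⟩
    by_contra hnot
    have hnot' : ω ∉ ((⋃ i, A i) ∪ (⋃ i, ⋃ j, B i j) ∪ ⋃ l, C l : Set Ω) := hnot
    simp only [Set.mem_union, Set.mem_iUnion, not_or, not_exists, A, B, C, Set.mem_ofPred_eq,
      not_le] at hnot'
    obtain ⟨⟨h1, h2⟩, h3⟩ := hnot'
    have h4 := hω.le_sigmaHatSq hΔ hn hK₄0.le hK₄ i (h1 i).le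
    have h5 := hω.abs_score_row_le n i j (c := K₄ ^ 2 / 16) (by positivity) hΔ hn
      (by linarith) (by positivity) (h2 i j).le (fun l => (h3 l).le)
    have h6 : γ ≤ |score (fun j : Fin d => φ j) n Δ (fun k => X (k * Δ) ω) i (row Θ i) j| := hij
    linarith
  refine (measure_mono_ae hsub).trans ?_
  have hd : (0 : ℝ) ≤ d := Nat.cast_nonneg d
  rw [ENNReal.ofReal_add (by positivity) (by positivity),
    ENNReal.ofReal_add (by positivity) (by positivity), ENNReal.ofReal_mul hd,
    ENNReal.ofReal_mul hd, ENNReal.ofReal_mul hd, ENNReal.ofReal_mul hd,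
    ENNReal.ofReal_mul zero_le_two, ENNReal.ofReal_mul zero_le_two, ENNReal.ofReal_natCast,
    ENNReal.ofReal_ofNat]
  refine (measure_union_le _ _).trans (add_le_add ((measure_union_le _ _).trans
    (add_le_add (measure_iUnion_fin_le hA) ?_)) (measure_iUnion_fin_le hC))
  exact measure_iUnion_fin_le fun i => measure_iUnion_fin_le (hB i)

end Feasibility

/-! ### Rates -/

section Rates

variable {p : ℕ → ℕ} {Δ : ℕ → ℝ≥0}

theorem tendsto_step {α : ℝ} (hα : 0 < α)
    (h : (fun n => (Δ n : ℝ)) =Θ[atTop] fun n : ℕ => (n : ℝ) ^ (-α)) :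
    Tendsto (fun n => (Δ n : ℝ)) atTop (𝓝 0) :=
  h.1.trans_tendsto ((tendsto_rpow_neg_atTop hα).comp tendsto_natCast_atTop_atTop)

theorem tendsto_sqrt_mul_step {α : ℝ} (hα : 1 / 2 < α)
    (h : (fun n => (Δ n : ℝ)) =Θ[atTop] fun n : ℕ => (n : ℝ) ^ (-α)) :
    Tendsto (fun n : ℕ => √(n : ℝ) * (Δ n : ℝ)) atTop (𝓝 0) := by
  have h1 : (fun n : ℕ => √(n : ℝ) * (Δ n : ℝ)) =O[atTop]
      fun n : ℕ => √(n : ℝ) * (n : ℝ) ^ (-α) := (isBigO_refl _ _).mul h.1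
  refine h1.trans_tendsto ?_
  have h2 := (tendsto_rpow_neg_atTop (y := α - 1 / 2) (by linarith)).comp
    (tendsto_natCast_atTop_atTop (R := ℝ))
  refine h2.congr' ?_
  filter_upwards [eventually_gt_atTop 0] with n hn
  rw [Real.sqrt_eq_rpow, ← Real.rpow_add (Nat.cast_pos.2 hn)]
  simp only [Function.comp]
  congr 1; ring

theorem log_one_add_sq_isBigO (hp : Tendsto p atTop atTop) :
    (fun n => Real.log (1 + (p n : ℝ) ^ 2)) =O[atTop] fun n => Real.log (p n) := by
  refine IsBigO.of_bound 3 ?_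
  filter_upwards [hp.eventually_ge_atTop 2] with n hn
  have h2 : (2 : ℝ) ≤ p n := by exact_mod_cast hn
  rw [Real.norm_of_nonneg (Real.log_nonneg (by nlinarith)),
    Real.norm_of_nonneg (Real.log_nonneg (by linarith))]
  calc Real.log (1 + (p n : ℝ) ^ 2) ≤ Real.log ((p n : ℝ) ^ 3) :=
        Real.log_le_log (by positivity) (by nlinarith [sq_nonneg ((p n : ℝ) - 1)])
    _ = 3 * Real.log (p n) := by rw [Real.log_pow]; norm_num

theorem tendsto_threshold (hp : Tendsto p atTop atTop)
    (hlog : (fun n => Real.log (p n)) =o[atTop] fun n => √(n * (Δ n : ℝ))) {γ : ℕ → ℝ}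
    (hγ : γ =Θ[atTop] fun n => Real.log (1 + (p n : ℝ) ^ 2) / √(n * (Δ n : ℝ))) :
    Tendsto γ atTop (𝓝 0) :=
  hγ.1.trans_tendsto ((log_one_add_sq_isBigO hp).trans_isLittleO hlog).tendsto_div_nhds_zero

theorem tendsto_dim_mul_exp (hp : Tendsto p atTop atTop)
    (hlog : (fun n => Real.log (p n)) =o[atTop] fun n => √(n * (Δ n : ℝ)))
    (hΔ : Tendsto (fun n => (Δ n : ℝ)) atTop (𝓝 0)) :
    Tendsto (fun n : ℕ => p n * Real.exp (-(n / 4 : ℝ))) atTop (𝓝 0) := by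
  have h1 : Tendsto (fun n : ℕ => Real.exp (-(n / 8 : ℝ))) atTop (𝓝 0) :=
    Real.tendsto_exp_neg_atTop_nhds_zero.comp
      (tendsto_natCast_atTop_atTop.atTop_div_const (by norm_num))
  refine tendsto_of_tendsto_of_tendsto_of_le_of_le' tendsto_const_nhds h1
    (Eventually.of_forall fun n => by positivity) ?_
  filter_upwards [hp.eventually_ge_atTop 1, hlog.bound (by norm_num : (0 : ℝ) < 1 / 8),
    hΔ.eventually_le_const one_pos, eventually_ge_atTop 1] with n hpn hln hΔn hn
  have hpn' : (0 : ℝ) < p n := Nat.cast_pos.2 hpn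
  have hn' : (1 : ℝ) ≤ n := by exact_mod_cast hn
  have h2 : √(n * (Δ n : ℝ)) ≤ n := by
    rw [Real.sqrt_le_left (by positivity)]
    nlinarith [(Δ n).coe_nonneg]
  rw [Real.norm_of_nonneg (Real.sqrt_nonneg _)] at hln
  have h3 := (le_abs_self _).trans hln
  nth_rewrite 1 [← Real.exp_log hpn']
  rw [← Real.exp_add]
  exact Real.exp_le_exp.2 (by linarith)

theorem tendsto_dim_mul_exp_sub_log (hp : Tendsto p atTop atTop) (C : ℝ) :
    Tendsto (fun n : ℕ => p n * Real.exp (C - Real.log (1 + (p n : ℝ) ^ 2))) atTop (𝓝 0) := by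
  have h1 : Tendsto (fun n : ℕ => Real.exp C / (p n : ℝ)) atTop (𝓝 0) :=
    tendsto_const_nhds.div_atTop (tendsto_natCast_atTop_atTop.comp hp)
  refine tendsto_of_tendsto_of_tendsto_of_le_of_le' tendsto_const_nhds h1
    (Eventually.of_forall fun n => by positivity) ?_
  filter_upwards [hp.eventually_ge_atTop 1] with n hpn
  have hpn' : (0 : ℝ) < p n := Nat.cast_pos.2 hpn
  rw [Real.exp_sub, Real.exp_log (by positivity), mul_div_assoc', div_le_div_iff₀ (by positivity)
    hpn']
  nlinarith [Real.exp_pos C]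

theorem tendsto_dim_sq_mul_exp_sub_log (hp : Tendsto p atTop atTop) (C : ℝ) :
    Tendsto (fun n : ℕ => p n * (p n * Real.exp (C - 2 * Real.log (1 + (p n : ℝ) ^ 2))))
      atTop (𝓝 0) := by
  have h1 := (tendsto_dim_mul_exp_sub_log hp C).mul (tendsto_dim_mul_exp_sub_log hp 0)
  rw [mul_zero] at h1
  refine h1.congr fun n => ?_
  rw [mul_mul_mul_comm, ← Real.exp_add, mul_assoc, zero_sub, ← sub_eq_add_neg, sub_sub, ← two_mul]

end Rates

/-! ### Consistency -/

section Consistency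

/-- The bound on the score splits into a stochastic term of the order of the threshold and a
discretization error of order `√Δ ℓ`, which is `√n Δ` times the threshold. Here `a = √n`,
`b = √Δ`, and `r` is the threshold, of order at least `ℓ / √(n Δ)`; `c` is chosen so that the
stochastic term takes up a quarter of it. -/
theorem score_bound_lt {a b c C D ℓ A L L' S K₁ K₃ K₄ r : ℝ} (ha : 0 < a) (hb : 0 < b)
    (hb1 : b ≤ 1) (hC : 0 < C) (hD : 0 ≤ D) (hℓ : 1 / 2 ≤ ℓ) (hA₀ : 0 ≤ A) (hK₃ : 0 < K₃)
    (hK₄ : 0 < K₄) (hc : c = K₄ ^ 2 / (64 * K₃ * C)) (hA : A = 16 * (L * S * K₁ * L') / K₄ ^ 2)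
    (hsmall : A * (2 * D + K₃) * (a * b ^ 2) ≤ 1 / (2 * C)) (hr : ℓ / (a * b) ≤ C * r) :
    1 / (a ^ 2 * b ^ 2 * (K₄ ^ 2 / 16)) * (K₃ * (c * (a * b) * ℓ)
      + L * (S * K₁ * (L' * (D * a ^ 2 * (b ^ 2) ^ 2 + K₃ * (a ^ 2 * b ^ 2 * b * ℓ))))) < r := by
  have hr' : ℓ / (a * b) / C ≤ r := by rwa [div_le_iff₀ hC, mul_comm r]
  have h1 : 1 / (a ^ 2 * b ^ 2 * (K₄ ^ 2 / 16)) * (K₃ * (c * (a * b) * ℓ)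
      + L * (S * K₁ * (L' * (D * a ^ 2 * (b ^ 2) ^ 2 + K₃ * (a ^ 2 * b ^ 2 * b * ℓ)))))
      = 1 / 4 * (ℓ / (a * b) / C) + A * (D * b ^ 2 + K₃ * (b * ℓ)) := by
    rw [hc, hA]
    field_simp
    ring
  have h2 : D * b ^ 2 ≤ D * (2 * (b * ℓ)) := by
    refine mul_le_mul_of_nonneg_left ?_ hD
    nlinarith
  have h3 : A * (D * b ^ 2 + K₃ * (b * ℓ)) ≤ A * (2 * D + K₃) * (b * ℓ) := by
    rw [mul_assoc]
    exact mul_le_mul_of_nonneg_left (by linarith) hA₀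
  have h4 : A * (2 * D + K₃) * (b * ℓ) = A * (2 * D + K₃) * (a * b ^ 2) * (ℓ / (a * b)) := by
    field_simp
  have hpos : 0 < ℓ / (a * b) := by positivity
  have h5 := mul_le_mul_of_nonneg_right hsmall hpos.le
  have h6 : 1 / (2 * C) * (ℓ / (a * b)) = 1 / 2 * (ℓ / (a * b) / C) := by field_simp
  have h7 : 0 < ℓ / (a * b) / C := by positivity
  linarith

variable {Ω : Type*} {F0 : MeasurableSpace Ω} {mΩ : MeasurableSpace Ω}
  {P : Measure Ω} {W : ℕ → ℝ≥0 → Ω → ℝ} {Θ : ℕ → ℕ → ℝ} {σ : ℕ → ℝ} {φ : ℕ → ℝ → ℝ} {S : ℕ}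
  {p : ℕ → ℕ} {Δ : ℕ → ℝ≥0} {X : (n : ℕ) → ℝ≥0 → Ω → Fin (p n) → ℝ} {γ : ℕ → ℝ}

/-- With probability tending to one, every true row satisfies its constraint strictly. -/
theorem tendsto_measure_exists_le_abs_score [IsProbabilityMeasure P] (hW : IsDrivingNoise F0 P W)
    (hS : IsSparse Θ S) (hX : ∀ n, IsSolution F0 P W Θ σ φ (p n) (X n))
    (hreg : Regularity P Θ σ φ p Δ X) (hγ₀ : ∀ n, 0 < γ n)
    (hγ : γ =Θ[atTop] fun n => Real.log (1 + (p n : ℝ) ^ 2) / √(n * (Δ n : ℝ))) :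
    Tendsto (fun n => P {ω | ∃ i j, γ n ≤ |score (fun j : Fin (p n) => φ j) n (Δ n)
      (sample (Δ n) (X n) ω) i (row Θ i) j|}) atTop (𝓝 0) := by
  obtain ⟨L, hL0, hL⟩ := hreg.phi_bounded
  obtain ⟨L', hL'0, hL'⟩ := hreg.phi_lipschitz
  obtain ⟨K₁, hK₁0, hK₁⟩ := hreg.drift_upper
  obtain ⟨K₃, hK₃0, hK₃⟩ := hreg.diff_upper
  obtain ⟨K₄, hK₄0, hK₄⟩ := hreg.diff_lower
  obtain ⟨α, hα, -, hΔα⟩ := hreg.step_order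
  obtain ⟨C, hC0, hC⟩ := hγ.2.exists_pos
  have hΔ := tendsto_step (by linarith) hΔα
  set c := K₄ ^ 2 / (64 * K₃ * C) with hc
  set A := 16 * (L * S * K₁ * L') / K₄ ^ 2 with hA
  set D := S * K₁ * L with hD
  have hc0 : 0 < c := by positivity
  have hA0 : 0 ≤ A := by positivity
  have hD0 : 0 ≤ D := by positivity
  -- the three terms of the union bound, for `t u = 2 ℓ` and `m = ℓ`
  have hlim := ((tendsto_dim_mul_exp hreg.dim_tendsto hreg.log_dim hΔ).add
    ((tendsto_dim_sq_mul_exp_sub_log hreg.dim_tendsto (2 * L ^ 2 / c ^ 2)).const_mul 2)).add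
    ((tendsto_dim_mul_exp_sub_log hreg.dim_tendsto (1 / 2)).const_mul 2)
  simp only [mul_zero, add_zero] at hlim
  have hlim' := (ENNReal.continuous_ofReal.tendsto 0).comp hlim
  rw [ENNReal.ofReal_zero] at hlim'
  refine tendsto_of_tendsto_of_tendsto_of_le_of_le' tendsto_const_nhds hlim'
    (Eventually.of_forall fun n => zero_le) ?_
  have hs1 : ∀ᶠ n in atTop, D ^ 2 * (Δ n : ℝ) ≤ K₄ ^ 2 / 16 := by
    have h := hΔ.const_mul (D ^ 2)
    rw [mul_zero] at h
    exact h.eventually_le_const (by positivity)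
  have hs2 : ∀ᶠ n : ℕ in atTop, A * (2 * D + K₃) * (√(n : ℝ) * Δ n) ≤ 1 / (2 * C) := by
    have h := (tendsto_sqrt_mul_step hα hΔα).const_mul (A * (2 * D + K₃))
    rw [mul_zero] at h
    exact h.eventually_le_const (by positivity)
  filter_upwards [hs1, hs2, hΔ.eventually_le_const one_pos, eventually_gt_atTop 0,
    hreg.dim_tendsto.eventually_ge_atTop 1, hC.bound] with n h1 h2 h3 hn hp hb
  have hp' : (1 : ℝ) ≤ p n := by exact_mod_cast hp
  have hn' : (0 : ℝ) < n := Nat.cast_pos.2 hn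
  have hΔn : (0 : ℝ) < Δ n := hreg.step_pos n
  set ℓ := Real.log (1 + (p n : ℝ) ^ 2) with hℓ
  have hℓ0 : 1 / 2 ≤ ℓ := by
    have := Real.log_le_log zero_lt_two (show (2 : ℝ) ≤ 1 + (p n : ℝ) ^ 2 by nlinarith)
    linarith [Real.log_two_gt_d9]
  have ha : 0 < √(n : ℝ) := Real.sqrt_pos.2 hn'
  have hb0 : 0 < √(Δ n : ℝ) := Real.sqrt_pos.2 hΔn
  have hna : √(n : ℝ) ^ 2 = n := Real.sq_sqrt hn'.le
  have hΔb : √(Δ n : ℝ) ^ 2 = Δ n := Real.sq_sqrt hΔn.le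
  have hsqrt : √(n * (Δ n : ℝ)) = √(n : ℝ) * √(Δ n : ℝ) := Real.sqrt_mul hn'.le _
  rw [hsqrt, Real.norm_of_nonneg (by positivity), Real.norm_of_nonneg (hγ₀ n).le] at hb
  have hbound := score_bound_lt (r := γ n) ha hb0 (Real.sqrt_le_one.2 h3) hC0 hD0 hℓ0 hA0 hK₃0
    hK₄0 hc hA (by rwa [hΔb]) hb
  rw [hna, hΔb] at hbound
  refine (measure_exists_le_abs_score_le hW (hX n) hS hL hL'0 hL' hK₁ hK₃ hK₄0 hK₄ hn
    (hreg.step_pos n) (t := 2 / (c * (√(n : ℝ) * √(Δ n : ℝ)))) (u := c * (√(n : ℝ) * √(Δ n : ℝ)) * ℓ)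
    (m := ℓ) (by positivity) (by linarith) h1 hbound).trans (ENNReal.ofReal_le_ofReal (le_of_eq ?_))
  have hexp : n * (Δ n : ℝ) * (2 / (c * (√(n : ℝ) * √(Δ n : ℝ))) * L) ^ 2 / 2
      - 2 / (c * (√(n : ℝ) * √(Δ n : ℝ))) * (c * (√(n : ℝ) * √(Δ n : ℝ)) * ℓ)
      = 2 * L ^ 2 / c ^ 2 - 2 * ℓ := by
    rw [← hna, ← hΔb, Real.sqrt_sq ha.le, Real.sqrt_sq hb0.le]
    field_simp
  rw [hexp]
  ring

theorem measurable_kappa (hW : IsDrivingNoise F0 P W) {d : ℕ} {Y : ℝ≥0 → Ω → Fin d → ℝ}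
    (hY : IsSolution F0 P W Θ σ φ d Y) (hφ : ∀ j, Measurable (φ j)) (n : ℕ) (δ : ℝ≥0) (i : Fin d) :
    Measurable fun ω => kappa Θ φ n δ Y i ω := by
  have hs : ∀ k j, Measurable fun ω => sample δ Y ω k j := fun k j =>
    (hY.adapted (k * δ) j).mono (hW.filt_le _) le_rfl
  refine (measurable_compatibilityFactor (supp (row Θ i))).comp
    (measurable_pi_lambda (fun ω j l => hessian (fun j : Fin d => φ j) n δ (sample δ Y ω) i j l)
      fun j => measurable_pi_lambda _ fun l => ?_)
  simp only [hessian, sigmaHatSq, Matrix.of_apply]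
  refine Measurable.mul ?_ (Finset.measurable_fun_sum _ fun k _ =>
    ((hφ j).comp (hs k j)).mul ((hφ l).comp (hs k l)))
  exact ((((Finset.measurable_fun_sum _ fun k _ =>
    ((hs (k + 1) i).sub (hs k i)).pow_const 2).const_mul _).const_mul _)).const_div _

/-- Some row has a nonzero entry, so that the factors are finite for that row as soon as the
dimension exceeds both indices. -/
theorem eventually_exists_supp_nonempty (hS : IsSparse Θ S) (hp : Tendsto p atTop atTop) :
    ∀ᶠ n in atTop, ∃ i : Fin (p n), (supp (row Θ i)).Nonempty := by
  have hex : ∃ i j, Θ i j ≠ 0 := by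
    by_contra! h
    have h1 : (S : ℕ∞) ≤ 0 := hS.2.2 (by
      rintro _ ⟨i, rfl⟩
      simp [h])
    have h2 : S ≤ 0 := by exact_mod_cast h1
    exact absurd hS.1 (by omega)
  obtain ⟨i, j, hij⟩ := hex
  filter_upwards [hp.eventually_gt_atTop i, hp.eventually_gt_atTop j] with n hi hj
  exact ⟨⟨i, hi⟩, ⟨j, hj⟩, mem_supp.2 hij⟩

theorem exists_le_of_le_iSup_fin {d : ℕ} [Nonempty (Fin d)] {f : Fin d → ℝ≥0∞} {c : ℝ≥0∞}
    (h : c ≤ ⨆ i, f i) : ∃ i, c ≤ f i := by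
  obtain ⟨i, hi⟩ := exists_eq_ciSup_of_finite (f := f)
  exact ⟨i, h.trans_eq hi.symm⟩

theorem compl_measure_le_of_one_sub_le [IsProbabilityMeasure P] {s : Set Ω} (hs : MeasurableSet s)
    {ε : ℝ} (h : ENNReal.ofReal (1 - ε) ≤ P s) : P sᶜ ≤ ENNReal.ofReal ε := by
  rw [prob_compl_eq_one_sub hs, tsub_le_iff_right]
  calc (1 : ℝ≥0∞) = ENNReal.ofReal (ε + (1 - ε)) := by simp
    _ ≤ ENNReal.ofReal ε + ENNReal.ofReal (1 - ε) := ENNReal.ofReal_add_le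
    _ ≤ _ := add_le_add_right h _

end Consistency

theorem theorem4p7 {Ω : Type*} (F0 : MeasurableSpace Ω) [mΩ : MeasurableSpace Ω]
    (P : Measure Ω) [IsProbabilityMeasure P]
    (W : ℕ → ℝ≥0 → Ω → ℝ) (hW : IsDrivingNoise F0 P W)
    (Θ : ℕ → ℕ → ℝ) (σ : ℕ → ℝ) (φ : ℕ → ℝ → ℝ)
    (S : ℕ) (hS : IsSparse Θ S)
    (p : ℕ → ℕ) (Δ : ℕ → ℝ≥0) (X : (n : ℕ) → ℝ≥0 → Ω → Fin (p n) → ℝ)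
    (hX : ∀ n, IsSolution F0 P W Θ σ φ (p n) (X n))
    (hreg : Regularity P Θ σ φ p Δ X)
    (hmat : MatrixCondition P Θ φ p Δ X)
    (γ : ℕ → ℝ) (hγ : ∀ n, 0 < γ n)
    (hγ_order : γ =Θ[atTop]
      fun n => Real.log (1 + (p n : ℝ) ^ 2) / √(n * (Δ n : ℝ)))
    (Θhat : (n : ℕ) → Fin (p n) → Ω → Fin (p n) → ℝ)
    (hΘhat : ∀ n i ω, IsDantzigSelector (fun j : Fin (p n) => φ j) n (Δ n) (γ n)
      (sample (Δ n) (X n) ω) i (Θhat n i ω)) :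
    Tendsto (fun n => P {ω |
        ENNReal.ofReal (8 * S * γ n) / (⨅ i : Fin (p n), kappa Θ φ n (Δ n) (X n) i ω ^ 2)
          ≤ ⨆ i : Fin (p n), ENNReal.ofReal (l1Norm (Θhat n i ω - row Θ i))})
      atTop (𝓝 0) ∧
    ∀ q : ℝ, 1 ≤ q →
      Tendsto (fun n => P {ω |
          ENNReal.ofReal (4 * (S : ℝ) ^ (1 / q) * γ n) /
              (⨅ i : Fin (p n), weakF q Θ φ n (Δ n) (X n) i ω)
            ≤ ⨆ i : Fin (p n), ENNReal.ofReal (lqNorm q (Θhat n i ω - row Θ i))})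
        atTop (𝓝 0) ∧
      ∀ ε : ℝ, 0 < ε →
        Tendsto (fun n => P {ω |
            ENNReal.ofReal ε ≤
              ⨆ i : Fin (p n), ENNReal.ofReal (lqNorm q (Θhat n i ω - row Θ i))})
          atTop (𝓝 0) := by
  have hΔ : ∀ n, (Δ n : ℝ) ≠ 0 := fun n => (NNReal.coe_pos.2 (hreg.step_pos n)).ne'
  have hbad := tendsto_measure_exists_le_abs_score hW hS hX hreg hγ hγ_order
  set B : ℕ → Set Ω := fun n => {ω | ∃ i j, γ n ≤ |score (fun j : Fin (p n) => φ j) n (Δ n)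
    (sample (Δ n) (X n) ω) i (row Θ i) j|} with hB
  have hgood : ∀ n ω, ω ∉ B n → ∀ i j, |score (fun j : Fin (p n) => φ j) n (Δ n)
      (sample (Δ n) (X n) ω) i (row Θ i) j| < γ n := fun n ω hω i j => by
    by_contra h
    exact hω ⟨i, j, not_lt.1 h⟩
  have hsupp := eventually_exists_supp_nonempty hS hreg.dim_tendsto
  refine ⟨?_, fun q hq => ⟨?_, fun ε hε => ?_⟩⟩
  · refine tendsto_of_tendsto_of_tendsto_of_le_of_le' tendsto_const_nhds hbad
      (Eventually.of_forall fun n => zero_le) ?_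
    filter_upwards [hsupp] with n ⟨i₀, hi₀⟩
    have : Nonempty (Fin (p n)) := ⟨i₀⟩
    refine measure_mono fun ω hω => ?_
    by_contra hnot
    obtain ⟨i, hi⟩ := exists_le_of_le_iSup_fin hω
    refine absurd hi (not_le.2 ((hΘhat n i ω).l1Norm_sub_lt (hΔ n) (hgood n ω hnot i) (hγ n) hS.1
      (card_supp_row_le hS i) ?_ (iInf_le _ i)))
    exact ne_top_of_le_ne_top (ENNReal.pow_ne_top (compatibilityFactor_ne_top hi₀ _).1)
      (iInf_le _ i₀)
  · refine tendsto_of_tendsto_of_tendsto_of_le_of_le' tendsto_const_nhds hbad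
      (Eventually.of_forall fun n => zero_le) ?_
    filter_upwards [hsupp] with n ⟨i₀, hi₀⟩
    have : Nonempty (Fin (p n)) := ⟨i₀⟩
    refine measure_mono fun ω hω => ?_
    by_contra hnot
    obtain ⟨i, hi⟩ := exists_le_of_le_iSup_fin hω
    refine absurd hi (not_le.2 ((hΘhat n i ω).lqNorm_sub_lt (hΔ n) (hgood n ω hnot i) (hγ n) hS.1
      (card_supp_row_le hS i) hq ?_ (iInf_le _ i)))
    exact ne_top_of_le_ne_top ((compatibilityFactor_ne_top hi₀ _).2 q) (iInf_le _ i₀)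
  · obtain ⟨L', hL'0, hL'⟩ := hreg.phi_lipschitz
    rw [ENNReal.tendsto_nhds_zero]
    intro η hη
    -- half of `η` is spent on the true rows, the other half on the matrix condition
    obtain ⟨r, hr0, hrη⟩ := ENNReal.lt_iff_exists_nnreal_btwn.1 (ENNReal.half_pos hη.ne')
    obtain ⟨δ, hδ, n₀, hn₀⟩ := hmat r (by exact_mod_cast hr0)
    have hγ0 := (tendsto_threshold hreg.dim_tendsto hreg.log_dim hγ_order).const_mul
      (8 * S / δ ^ 2)
    rw [mul_zero] at hγ0
    filter_upwards [hsupp, eventually_ge_atTop n₀, hγ0.eventually_lt_const hε,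
      ENNReal.tendsto_nhds_zero.1 hbad _ (ENNReal.half_pos hη.ne')] with n ⟨i₀, _⟩ hn hγε hBn
    have : Nonempty (Fin (p n)) := ⟨i₀⟩
    set G : Set Ω := {ω | ENNReal.ofReal δ < ⨅ i : Fin (p n), kappa Θ φ n (Δ n) (X n) i ω} with hG
    have hGm : MeasurableSet G := measurableSet_lt measurable_const
      (Measurable.iInf fun i => measurable_kappa hW (hX n)
        (fun j => (continuous_of_abs_sub_le hL'0 (hL' j)).measurable) n (Δ n) i)
    have hGc : P Gᶜ ≤ η / 2 := by
      refine (compl_measure_le_of_one_sub_le hGm (hn₀ n hn)).trans ?_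
      rw [ENNReal.ofReal_coe_nnreal]
      exact hrη.le
    rw [← ENNReal.add_halves η]
    refine le_trans (measure_mono fun ω hω => ?_) ((measure_union_le (B n) Gᶜ).trans
      (add_le_add hBn hGc))
    by_contra hnot
    rw [Set.mem_union, not_or, Set.mem_compl_iff, not_not] at hnot
    obtain ⟨i, hi⟩ := exists_le_of_le_iSup_fin hω
    have h1 := (hΘhat n i ω).l1Norm_sub_le (hΔ n) (hgood n ω hnot.1 i) (hγ n) hS.1
      (card_supp_row_le hS i) hδ (hnot.2.le.trans (iInf_le _ i))
    have h2 := lqNorm_le_l1Norm hq (Θhat n i ω - row Θ i)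
    have h3 : ε ≤ lqNorm q (Θhat n i ω - row Θ i) :=
      (ENNReal.ofReal_le_ofReal_iff (Real.rpow_nonneg (Finset.sum_nonneg fun _ _ =>
        Real.rpow_nonneg (abs_nonneg _) _) _)).1 hi
    rw [div_mul_eq_mul_div] at hγε
    linarith
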